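/- Let $\mathcal M=\{A,B,C,D\}$ be a real minimal (controllable and observable) state-space model with $n$ states, $m$ inputs and $m$ outputs, and let $Z(s)=C(sI_n-A)^{-1}B+D$ and $\Phi(s)=Z(-s)^{\mathsf T}+Z(s)$. Call such a model strictly passive if all eigenvalues of $A$ have negative real part and $\Phi(\imath\omega)\succ0$ for all $\omega\in\mathbb R$, and assume that $\mathcal M$ is strictly passive. For $\xi\in\mathbb R$ put $\mathcal M_\xi=\{A+\frac\xi2I_n,B,C,D-\frac\xi2I_m\}$, with transfer function $Z_\xi(s)=Z(s-\frac\xi2)-\frac\xi2I_m$, and let $$\Xi:=\sup\{\xi\in\mathbb R \mid \mathcal M_\xi\text{ is strictly passive}\}.$$ Let $\xi\in(0,\Xi)$, and let real matrices $U_\xi,V_\xi\in\mathbb R^{n\times\hat n}$, $W_\xi\in\mathbb R^{m\times\hat n}$, $R_\xi\in\mathbb R^{\hat n\times\hat n}$ be such that the stacked matrix $[U_\xi;V_\xi;W_\xi]$ has linearly independent columns, all eigenvalues of $R_\xi$ lie in the open right half plane, and, identically in $s$, $$\begin{bmatrix}0&A+\frac\xi2I_n-sI_n&B\\A^{\mathsf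 T}+\frac\xi2I_n+sI_n&0&C^{\mathsf T}\\B^{\mathsf T}&C&D^{\mathsf T}+D-\xi I_m\end{bmatrix}\begin{bmatrix}U_\xi\\V_\xi\\W_\xi\end{bmatrix}=\begin{bmatrix}V_\xi\\-U_\xi\\0\end{bmatrix}(R_\xi-sI_{\hat n}).$$ Then: 1. $U_\xi$ and $V_\xi$ have full column rank $\hat n$, and $\hat X_\xi:=-U_\xi^{\mathsf T}V_\xi$ is symmetric positive definite. 2. Let $\hat{\mathcal M}=\{\hat A,\hat B,\hat C,\hat D\}:=\{(U_\xi^{\mathsf T}V_\xi)^{-1}U_\xi^{\mathsf T}AV_\xi,\ (U_\xi^{\mathsf T}V_\xi)^{-1}U_\xi^{\mathsf T}B,\ CV_\xi,\ D\}$, with transfer function $\hat Z(s)=\hat C(sI_{\hat n}-\hat A)^{-1}\hat B+\hat D$. Then $Z(s)\to D$ and $\hat Z(s)\to D$ as $s\to\infty$. For every $\sigma\in\mathbb C$ and $0\ne r\in\mathbb C^{\hat n}$ with $R_\xi r=\sigma r$, the point $\sigma-\frac\xi2$ is an eigenvalue of neither $A$ nor $\hat A$, and $$Z(\sigma-\tfrac\xi2)W_\xi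 r=\hat Z(\sigma-\tfrac\xi2)W_\xi r;$$ and if $-\sigma-\frac\xi2$ is an eigenvalue of neither $A$ nor $\hat A$, then $$r^{\mathsf T}W_\xi^{\mathsf T}Z(-\sigma-\tfrac\xi2)=r^{\mathsf T}W_\xi^{\mathsf T}\hat Z(-\sigma-\tfrac\xi2).$$ 3. The following linear matrix inequality holds: $$\mathcal W(\hat X_\xi,\hat{\mathcal M}):=\begin{bmatrix}-\hat X_\xi\hat A-\hat A^{\mathsf T}\hat X_\xi&\hat C^{\mathsf T}-\hat X_\xi\hat B\\\hat C-\hat B^{\mathsf T}\hat X_\xi&\hat D^{\mathsf T}+\hat D\end{bmatrix}\succeq\xi\,\mathrm{diag}(\hat X_\xi,I_m)\succ0 .$$ 4. For every real square matrix $T_\xi$ with $\hat X_\xi=T_\xi^{\mathsf T}T_\xi$, the model $\hat{\mathcal M}_{T_\xi}:=\{T_\xi\hat AT_\xi^{-1},T_\xi\hat B,\hat CT_\xi^{-1},\hat D\}$ is a normalized port-Hamiltonian model, i.e. it equals $\{\hat J-\hat R,\hat G-\hat P,(\hat G+\hat P)^{\mathsf T},\hat N+\hat S\}$ with $\hat J,\hat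 N$ skew-symmetric and $\begin{bmatrix}\hat R&\hat P\\\hat P^{\mathsf T}&\hat S\end{bmatrix}$ symmetric positive semi-definite. Its passivity radius is at least $\xi/2$. Here the passivity radius is the infimum of the norms of the complex perturbations $\Delta=\{\Delta_A,\Delta_B,\Delta_C,\Delta_D\}$ for which the perturbed model is not passive, the norm being the spectral norm or the Frobenius norm of $\begin{bmatrix}\Delta_A&\Delta_B\\\Delta_C&\Delta_D\end{bmatrix}$. A complex model with transfer function $Z$ is passive if all eigenvalues of its state matrix have non-positive real part, those on the imaginary axis being semi-simple; $Z(\imath\omega)^{\mathsf H}+Z(\imath\omega)\succeq0$ at every $\imath\omega$ ($\omega\in\mathbb R$) that is not an eigenvalue of the state matrix; and $\lim_{s\to\imath\omega}(s-\imath\omega)Z(s)$ exists and is Hermitian positive semi-definite at every eigenvalue $\imath\omega$. In both norms, moreover, the $I$-passivity radius, i.e. the infimum of the norms of the complex $\Delta$ for which $\mathcal W(I,\hat{\mathcal M}_{T_\xi}+\Delta)$ is singular (with conjugate transposes in $\mathcal W$), is also at least $\xi/2$. -/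

import Mathlib

open scoped ComplexOrder Matrix

noncomputable section

namespace PassiveLTI

/-- A state-space model `{A, B, C, D}` with `n` states, `m` inputs and `m` outputs. -/
@[ext]
structure Model (𝕜 : Type) (n m : ℕ) where
  A : Matrix (Fin n) (Fin n) 𝕜
  B : Matrix (Fin n) (Fin m) 𝕜
  C : Matrix (Fin m) (Fin n) 𝕜
  D : Matrix (Fin m) (Fin m) 𝕜

/-- Entrywise embedding of real matrices into complex ones. -/
def cpx {ι κ : Type} (M : Matrix ι κ ℝ) : Matrix ι κ ℂ := M.map Complex.ofReal

/-- A real model regarded as a complex one. -/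
def Model.toComplex {n m : ℕ} (M : Model ℝ n m) : Model ℂ n m :=
  ⟨cpx M.A, cpx M.B, cpx M.C, cpx M.D⟩

/-- `μ` is an eigenvalue of the complex square matrix `A`. -/
def IsEigenvalue {k : ℕ} (A : Matrix (Fin k) (Fin k) ℂ) (μ : ℂ) : Prop :=
  Module.End.HasEigenvalue (Matrix.toLin' A) μ

/-! ### Minimality -/

/-- Controllability: the matrix `[B, AB, …, Aⁿ⁻¹B]` has rank `n`. -/
def Model.Controllable {n m : ℕ} (M : Model ℝ n m) : Prop :=
  (Matrix.of fun (i : Fin n) (p : Fin n × Fin m) => (M.A ^ (p.1 : ℕ) * M.B) i p.2).rank = n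

/-- Observability: the matrix with block rows `C, CA, …, CAⁿ⁻¹` has rank `n`. -/
def Model.Observable {n m : ℕ} (M : Model ℝ n m) : Prop :=
  (Matrix.of fun (p : Fin n × Fin m) (j : Fin n) => (M.C * M.A ^ (p.1 : ℕ)) p.2 j).rank = n

/-- A realization is minimal if it is controllable and observable. -/
def Model.Minimal {n m : ℕ} (M : Model ℝ n m) : Prop := M.Controllable ∧ M.Observable

/-! ### Transfer functions, positive realness and passivity

The notions are set up for complex models, because passivity radii are measured with complex
perturbations; for real models `conjTranspose` of a coefficient matrix is `transpose`. -/

/-- The transfer function `Z(s) = C (s I - A)⁻¹ B + D`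
(meaningful when `s` is not an eigenvalue of `A`). -/
def Model.transfer {n m : ℕ} (M : Model ℂ n m) (s : ℂ) : Matrix (Fin m) (Fin m) ℂ :=
  M.C * (s • (1 : Matrix (Fin n) (Fin n) ℂ) - M.A)⁻¹ * M.B + M.D

/-- The para-Hermitian function `Φ(s) = Z(-s̄)ᴴ + Z(s)`; for a real model it is
`Z(-s)ᵀ + Z(s)`, see `popov_toComplex`. -/
def Model.popov {n m : ℕ} (M : Model ℂ n m) (s : ℂ) : Matrix (Fin m) (Fin m) ℂ :=
  (M.transfer (-(starRingEnd ℂ s)))ᴴ + M.transfer s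

theorem popov_toComplex {n m : ℕ} (M : Model ℝ n m) (s : ℂ) :
    M.toComplex.popov s = (M.toComplex.transfer (-s))ᵀ + M.toComplex.transfer s := by
  have hreal : ∀ {ι κ : Type} (N : Matrix ι κ ℝ), (cpx N)ᴴ = (cpx N)ᵀ := by
    intro ι κ N
    ext i j
    simp [cpx]
  unfold Model.popov
  congr 1
  simp only [Model.transfer, Matrix.conjTranspose_add, Matrix.transpose_add,
    Matrix.conjTranspose_mul, Matrix.transpose_mul, Matrix.conjTranspose_nonsing_inv,
    Matrix.transpose_nonsing_inv, Matrix.conjTranspose_sub, Matrix.transpose_sub,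
    Matrix.conjTranspose_smul, Matrix.transpose_smul, Matrix.conjTranspose_one,
    Matrix.transpose_one, Model.toComplex, hreal]
  simp

theorem popov_axis {n m : ℕ} (M : Model ℂ n m) (ω : ℝ) :
    M.popov (Complex.I * ω) =
      (M.transfer (Complex.I * ω))ᴴ + M.transfer (Complex.I * ω) := by
  simp [Model.popov]

/-- Asymptotic stability: all eigenvalues of `A` lie in the open left half plane. -/
def Model.AsymptoticallyStable {n m : ℕ} (M : Model ℂ n m) : Prop :=
  ∀ μ : ℂ, IsEigenvalue M.A μ → μ.re < 0

/-- Stability: all eigenvalues of `A` lie in the closed left half plane, and those on the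
imaginary axis are semi-simple. -/
def Model.Stable {n m : ℕ} (M : Model ℂ n m) : Prop :=
  ∀ μ : ℂ, IsEigenvalue M.A μ → μ.re ≤ 0 ∧
    (μ.re = 0 → ∀ v : Fin n → ℂ,
      (M.A - μ • 1) *ᵥ ((M.A - μ • 1) *ᵥ v) = 0 → (M.A - μ • 1) *ᵥ v = 0)

/-- Strict positive realness: `Φ(iω) ≻ 0` for all real `ω` (and `iω` is a point where
`Z` is defined). -/
def Model.StrictlyPositiveReal {n m : ℕ} (M : Model ℂ n m) : Prop :=
  ∀ ω : ℝ, ¬ IsEigenvalue M.A (Complex.I * ω) ∧ (M.popov (Complex.I * ω)).PosDef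

/-- Positive realness: `Φ(iω) ⪰ 0` for all real `ω` at which `Z` is defined. -/
def Model.PositiveReal {n m : ℕ} (M : Model ℂ n m) : Prop :=
  ∀ ω : ℝ, ¬ IsEigenvalue M.A (Complex.I * ω) → (M.popov (Complex.I * ω)).PosSemidef

/-- Strict passivity: strictly positive real and asymptotically stable. -/
def Model.StrictlyPassive {n m : ℕ} (M : Model ℂ n m) : Prop :=
  M.StrictlyPositiveReal ∧ M.AsymptoticallyStable

/-- Passivity: positive real and stable, with Hermitian positive semi-definite residues
`lim (s - iω) Z(s)` at the poles on the imaginary axis. -/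
def Model.Passive {n m : ℕ} (M : Model ℂ n m) : Prop :=
  M.PositiveReal ∧ M.Stable ∧
    ∀ ω : ℝ, IsEigenvalue M.A (Complex.I * ω) →
      ∃ K : Matrix (Fin m) (Fin m) ℂ, K.PosSemidef ∧
        Filter.Tendsto (fun s : ℂ => (s - Complex.I * ω) • M.transfer s)
          (nhdsWithin (Complex.I * ω) {Complex.I * ω}ᶜ) (nhds K)

/-! ### The shifted model -/

/-- The shifted model `M_ξ = {A + (ξ/2) I, B, C, D - (ξ/2) I}`. -/
def Model.shift {n m : ℕ} (M : Model ℝ n m) (ξ : ℝ) : Model ℝ n m :=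
  ⟨M.A + (ξ / 2) • 1, M.B, M.C, M.D - (ξ / 2) • 1⟩

/-- The transfer function of `M_ξ` is `Z_ξ(s) = Z(s - ξ/2) - (ξ/2) I`. -/
theorem transfer_shift {n m : ℕ} (M : Model ℝ n m) (ξ : ℝ) (s : ℂ) :
    (M.shift ξ).toComplex.transfer s =
      M.toComplex.transfer (s - (ξ : ℂ) / 2) - ((ξ : ℂ) / 2) • 1 := by
  have h1 : ∀ k : ℕ, ∀ c : ℝ,
      cpx (c • (1 : Matrix (Fin k) (Fin k) ℝ)) = (c : ℂ) • 1 := by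
    intro k c
    ext i j
    by_cases h : i = j <;> simp [cpx, h]
  have hA : cpx (M.A + (ξ / 2) • 1) = cpx M.A + ((ξ : ℂ) / 2) • 1 := by
    have := h1 n (ξ / 2)
    push_cast at this
    rw [← this]
    ext i j
    simp [cpx]
  have hD : cpx (M.D - (ξ / 2) • 1) = cpx M.D - ((ξ : ℂ) / 2) • 1 := by
    have := h1 m (ξ / 2)
    push_cast at this
    rw [← this]
    ext i j
    simp [cpx]
  simp only [Model.transfer, Model.toComplex, Model.shift, hA, hD]
  have : s • (1 : Matrix (Fin n) (Fin n) ℂ) - (cpx M.A + ((ξ : ℂ) / 2) • 1)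
      = (s - (ξ : ℂ) / 2) • 1 - cpx M.A := by
    rw [sub_smul]; abel
  rw [this]; abel

/-- `Ξ = sup {ξ | Z_ξ is strictly passive}`, as an extended real number. -/
def Model.shiftSup {n m : ℕ} (M : Model ℝ n m) : EReal :=
  ⨆ ξ ∈ {ξ : ℝ | (M.shift ξ).toComplex.StrictlyPassive}, (ξ : EReal)

/-! ### The system pencil and its deflating subspaces -/

/-- The system matrix
`S(s) = [0, A - sI, B; Aᵀ + sI, 0, Cᵀ; Bᵀ, C, Dᵀ + D]` of `Φ`. -/
def Model.pencil {n m : ℕ} (M : Model ℝ n m) (s : ℝ) :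
    Matrix ((Fin n ⊕ Fin n) ⊕ Fin m) ((Fin n ⊕ Fin n) ⊕ Fin m) ℝ :=
  Matrix.fromBlocks
    (Matrix.fromBlocks 0 (M.A - s • 1) (M.Aᵀ + s • 1) 0)
    (Matrix.fromRows M.B M.Cᵀ)
    (Matrix.fromCols M.Bᵀ M.C)
    (M.Dᵀ + M.D)

/-- The columns of `[U; V; W]` are a basis of a `k`-dimensional deflating subspace of the pencil
`S(s)` with spectral part `R`: they are linearly independent and
`S(s) [U; V; W] = [V; -U; 0] (R - sI)` identically in `s`. -/
def Model.IsDeflatingBasis {n m k : ℕ} (M : Model ℝ n m)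
    (U V : Matrix (Fin n) (Fin k) ℝ) (W : Matrix (Fin m) (Fin k) ℝ)
    (R : Matrix (Fin k) (Fin k) ℝ) : Prop :=
  LinearIndependent ℝ (Matrix.fromRows (Matrix.fromRows U V) W).col ∧
  ∀ s : ℝ, M.pencil s * Matrix.fromRows (Matrix.fromRows U V) W =
    Matrix.fromRows (Matrix.fromRows V (-U)) (0 : Matrix (Fin m) (Fin k) ℝ) * (R - s • 1)

/-- The projected model `{(UᵀV)⁻¹UᵀAV, (UᵀV)⁻¹UᵀB, CV, D}`. -/
def Model.project {n m k : ℕ} (M : Model ℝ n m) (U V : Matrix (Fin n) (Fin k) ℝ) :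
    Model ℝ k m :=
  ⟨(Uᵀ * V)⁻¹ * Uᵀ * M.A * V, (Uᵀ * V)⁻¹ * Uᵀ * M.B, M.C * V, M.D⟩

/-! ### The passivity linear matrix inequality -/

/-- `𝒲(X, M) = [-AᴴX - XA, Cᴴ - XB; C - BᴴX, Dᴴ + D]`; over `ℝ` the conjugate transpose
is the transpose, see `lmi_real`. -/
def Model.lmi {𝕜 : Type} [CommRing 𝕜] [StarRing 𝕜] {n m : ℕ} (M : Model 𝕜 n m)
    (X : Matrix (Fin n) (Fin n) 𝕜) : Matrix (Fin n ⊕ Fin m) (Fin n ⊕ Fin m) 𝕜 :=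
  Matrix.fromBlocks (-(M.Aᴴ * X) - X * M.A) (M.Cᴴ - X * M.B)
    (M.C - M.Bᴴ * X) (M.Dᴴ + M.D)

theorem lmi_real {n m : ℕ} (M : Model ℝ n m) (X : Matrix (Fin n) (Fin n) ℝ) :
    M.lmi X = Matrix.fromBlocks (-(M.Aᵀ * X) - X * M.A) (M.Cᵀ - X * M.B)
      (M.C - M.Bᵀ * X) (M.Dᵀ + M.D) := by
  simp [Model.lmi, Matrix.conjTranspose_eq_transpose_of_trivial]

/-! ### Port-Hamiltonian realizations -/

/-- `M` is the port-Hamiltonian model `{(J - R)Q, G - P, (G + P)ᵀQ, N + S}`. -/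
def Model.IsPortHamiltonian {n m : ℕ} (M : Model ℝ n m) (Q : Matrix (Fin n) (Fin n) ℝ) : Prop :=
  ∃ (J R : Matrix (Fin n) (Fin n) ℝ) (G P : Matrix (Fin n) (Fin m) ℝ)
    (N S : Matrix (Fin m) (Fin m) ℝ),
    Matrix.fromBlocks (-J) (-G) Gᵀ N = -(Matrix.fromBlocks (-J) (-G) Gᵀ N)ᵀ ∧
    (Matrix.fromBlocks R P Pᵀ S).PosSemidef ∧
    Q.PosSemidef ∧
    M = ⟨(J - R) * Q, G - P, (G + P)ᵀ * Q, N + S⟩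

/-- A normalized port-Hamiltonian model: `Q = I`. -/
def Model.IsNormalizedPortHamiltonian {n m : ℕ} (M : Model ℝ n m) : Prop :=
  M.IsPortHamiltonian 1

/-- The state-space transformation `{T A T⁻¹, T B, C T⁻¹, D}`. -/
def Model.transform {n m : ℕ} (M : Model ℝ n m) (T : Matrix (Fin n) (Fin n) ℝ) : Model ℝ n m :=
  ⟨T * M.A * T⁻¹, T * M.B, M.C * T⁻¹, M.D⟩

/-! ### Passivity radii -/

/-- The perturbed model `M + Δ`. -/
def Model.perturb {n m : ℕ} (M Δ : Model ℂ n m) : Model ℂ n m :=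
  ⟨M.A + Δ.A, M.B + Δ.B, M.C + Δ.C, M.D + Δ.D⟩

/-- The block matrix `[A, B; C, D]`. -/
def Model.blockMatrix {n m : ℕ} (M : Model ℂ n m) : Matrix (Fin n ⊕ Fin m) (Fin n ⊕ Fin m) ℂ :=
  Matrix.fromBlocks M.A M.B M.C M.D

/-- The spectral norm `‖[A, B; C, D]‖₂`. -/
def specNorm {n m : ℕ} (Δ : Model ℂ n m) : ℝ :=
  ‖Matrix.toEuclideanCLM (n := Fin n ⊕ Fin m) (𝕜 := ℂ) Δ.blockMatrix‖

/-- The Frobenius norm `‖[A, B; C, D]‖_F`. -/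
def frobNorm {n m : ℕ} (Δ : Model ℂ n m) : ℝ :=
  Real.sqrt (∑ i, ∑ j, ‖Δ.blockMatrix i j‖ ^ 2)

/-- The passivity radius of `M`, perturbations being measured by `ν`: the infimum of `ν Δ` over
the perturbations for which `M + Δ` is not passive (`+∞` if there are none). -/
def Model.passivityRadius {n m : ℕ} (ν : Model ℂ n m → ℝ) (M : Model ℝ n m) : EReal :=
  ⨅ Δ ∈ {Δ : Model ℂ n m | ¬ (M.toComplex.perturb Δ).Passive}, (ν Δ : EReal)

/-- The `X`-passivity radius of `M`: the infimum of `ν Δ` over the perturbations for which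
`𝒲(X, M + Δ)` is singular. -/
def Model.certPassivityRadius {n m : ℕ} (ν : Model ℂ n m → ℝ) (M : Model ℝ n m)
    (X : Matrix (Fin n) (Fin n) ℝ) : EReal :=
  ⨅ Δ ∈ {Δ : Model ℂ n m | ((M.toComplex.perturb Δ).lmi (cpx X)).det = 0}, (ν Δ : EReal)

end PassiveLTI

end

open PassiveLTI

open PassiveLTI

/-! ### Eigenvalues, resolvents and intertwining. -/

namespace PassiveLTI

/-! For ξ < Ξ the shifted model is itself strictly passive: some strictly passive shift η > ξ
exists, and Z_ξ(iω) is Z_η evaluated to the right of the imaginary axis plus a positive multiple of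
I (`strictlyPassive_shift_of_lt_shiftSup`). It then remains to study the shifted model.

The deflating equations give the Lyapunov identity XR + RᵀX = Wᵀ(CV + D_ξ W) + (CV + D_ξ W)ᵀW for X
= -UᵀV (`Model.Deflates.lyapunov`). It is an energy balance: since R is antistable, a vector r
generates a trajectory on (-∞, 0] with state V exp(tR) r and input W exp(tR) r, and rᴴXr is the
energy supplied along it. By Parseval this energy would be an integral of ûᴴΦû over the imaginary
axis, hence non-negative. The proof replaces the integral by the maximum principle. After a Cayley
transform, ûᴴΦû on the unit circle equals a constant multiple of rᴴXr minus Re(zF(z)), with F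
analytic on the closed disc (`Model.Deflates.popov_eq_energyDisc`). As zF(z) vanishes at 0, the
constant is non-negative, and it is zero only if ûᴴΦû vanishes on the circle
(`nonneg_of_re_mul_le_on_circle`).

If rᴴXr = 0, strictness of Φ gives W Rʲ r = 0 for all j. Then V intertwines the powers of R and of
the shifted A on r, and their disjoint spectra force Vr = 0. The remaining equations place Ur in the
kernel of the transposed controllability matrix, so Ur = 0, and r = 0 by independence of the
columns. This makes X positive definite (`Model.IsDeflatingBasis.posDef`).

The other claims are algebra. The inequality defect 𝒲(X, M̂) - ξ diag(X, I) equals [-W, I]ᵀ(D_ξᵀ +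
D_ξ)[-W, I], and D_ξᵀ + D_ξ is a limit of Φ_ξ on the axis. An eigenvector r of R supplies matching
states Vr and r, and matching dual states Ur and UᵀVr, of the two models; this is interpolation.
Congruence by T turns the inequality into 𝒲(I, ·) ⪰ ξI, and a perturbation Δ changes this quadratic
form by at most 2‖Δ‖. -/

theorem isEigenvalue_iff {k : ℕ} {A : Matrix (Fin k) (Fin k) ℂ} {μ : ℂ} :
    IsEigenvalue A μ ↔ ∃ v : Fin k → ℂ, v ≠ 0 ∧ A *ᵥ v = μ • v := by
  constructor
  · intro h
    obtain ⟨v, hv⟩ := h.exists_hasEigenvector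
    exact ⟨v, hv.2, by simpa using hv.apply_eq_smul⟩
  · rintro ⟨v, hv, h⟩
    exact Module.End.hasEigenvalue_of_hasEigenvector
      (Module.End.hasEigenvector_iff.2 ⟨Module.End.mem_eigenspace_iff.2 (by simpa using h), hv⟩)

theorem isUnit_of_mulVec_injective {k : ℕ} {A : Matrix (Fin k) (Fin k) ℂ}
    (h : ∀ v, A *ᵥ v = 0 → v = 0) : IsUnit A := by
  rw [Matrix.isUnit_iff_isUnit_det, isUnit_iff_ne_zero]
  intro h0
  obtain ⟨v, hv, h1⟩ := Matrix.exists_mulVec_eq_zero_iff.2 h0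
  exact hv (h v h1)

theorem isUnit_resolvent {k : ℕ} {A : Matrix (Fin k) (Fin k) ℂ} {s : ℂ}
    (h : ¬ IsEigenvalue A s) : IsUnit (s • (1 : Matrix (Fin k) (Fin k) ℂ) - A) := by
  refine isUnit_of_mulVec_injective fun v hv => ?_
  by_contra h0
  refine h (isEigenvalue_iff.2 ⟨v, h0, ?_⟩)
  rw [Matrix.sub_mulVec, Matrix.smul_mulVec, Matrix.one_mulVec, sub_eq_zero] at hv
  exact hv.symm

/-- The homogeneous form a - bA keeps the point at infinity: b = 0 is the image of z = -1 under the
Cayley transform used below. -/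
theorem isUnit_smul_one_sub_smul {k : ℕ} {A : Matrix (Fin k) (Fin k) ℂ} {a b : ℂ}
    (h0 : b = 0 → a ≠ 0) (h : b ≠ 0 → ¬ IsEigenvalue A (a / b)) :
    IsUnit (a • (1 : Matrix (Fin k) (Fin k) ℂ) - b • A) := by
  by_cases hb : b = 0
  · rw [hb, zero_smul, sub_zero]
    exact (isUnit_one.smul (Units.mk0 a (h0 hb)))
  · have h1 : a • (1 : Matrix (Fin k) (Fin k) ℂ) - b • A = b • ((a / b) • 1 - A) := by
      rw [smul_sub, smul_smul, mul_div_cancel₀ _ hb]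
    rw [h1]
    exact (isUnit_resolvent (h hb)).smul (Units.mk0 b hb)

theorem isEigenvalue_of_not_isUnit {k : ℕ} {A : Matrix (Fin k) (Fin k) ℂ} {s : ℂ}
    (h : ¬ IsUnit (s • (1 : Matrix (Fin k) (Fin k) ℂ) - A)) : IsEigenvalue A s := by
  by_contra h1
  exact h (isUnit_resolvent h1)

theorem not_isUnit_of_isEigenvalue {k : ℕ} {A : Matrix (Fin k) (Fin k) ℂ} {s : ℂ}
    (h : IsEigenvalue A s) : ¬ IsUnit (s • (1 : Matrix (Fin k) (Fin k) ℂ) - A) := by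
  obtain ⟨v, hv, h1⟩ := isEigenvalue_iff.1 h
  intro hu
  refine hv (Matrix.mulVec_injective_of_isUnit hu ?_)
  rw [Matrix.sub_mulVec, Matrix.smul_mulVec, Matrix.one_mulVec, h1, sub_self, Matrix.mulVec_zero]

theorem isEigenvalue_conjTranspose {k : ℕ} {A : Matrix (Fin k) (Fin k) ℂ} {s : ℂ}
    (h : IsEigenvalue Aᴴ s) : IsEigenvalue A (starRingEnd ℂ s) := by
  refine isEigenvalue_of_not_isUnit fun hu => not_isUnit_of_isEigenvalue h ?_
  rw [← Matrix.isUnit_conjTranspose] at hu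
  simpa [Matrix.conjTranspose_sub, Matrix.conjTranspose_smul] using hu

theorem isEigenvalue_transpose {k : ℕ} {A : Matrix (Fin k) (Fin k) ℂ} {s : ℂ}
    (h : IsEigenvalue Aᵀ s) : IsEigenvalue A s := by
  refine isEigenvalue_of_not_isUnit fun hu => not_isUnit_of_isEigenvalue h ?_
  rw [← Matrix.isUnit_transpose] at hu
  simpa using hu

theorem isEigenvalue_neg {k : ℕ} {A : Matrix (Fin k) (Fin k) ℂ} {s : ℂ}
    (h : IsEigenvalue (-A) s) : IsEigenvalue A (-s) := by
  obtain ⟨v, hv, h1⟩ := isEigenvalue_iff.1 h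
  refine isEigenvalue_iff.2 ⟨v, hv, ?_⟩
  rw [neg_smul, ← h1, Matrix.neg_mulVec, neg_neg]

theorem isEigenvalue_add_smul_one {k : ℕ} {A : Matrix (Fin k) (Fin k) ℂ} {s c : ℂ} :
    IsEigenvalue (A + c • 1) s ↔ IsEigenvalue A (s - c) := by
  simp only [isEigenvalue_iff, Matrix.add_mulVec, Matrix.smul_mulVec, Matrix.one_mulVec, sub_smul,
    eq_sub_iff_add_eq]

open Polynomial in
/-- If `V` intertwines the powers of `R` and `A` on the vector `r` and `A`, `R` have no common
eigenvalue, then `V r = 0`. -/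
theorem mulVec_eq_zero_of_intertwine {n k : ℕ} {A : Matrix (Fin n) (Fin n) ℂ}
    {R : Matrix (Fin k) (Fin k) ℂ} {V : Matrix (Fin n) (Fin k) ℂ} {r : Fin k → ℂ}
    (h : ∀ j : ℕ, (A ^ j) *ᵥ (V *ᵥ r) = V *ᵥ ((R ^ j) *ᵥ r))
    (hd : ∀ μ, IsEigenvalue A μ → ¬ IsEigenvalue R μ) : V *ᵥ r = 0 := by
  have hp : ∀ p : ℂ[X], (aeval A p) *ᵥ (V *ᵥ r) = V *ᵥ ((aeval R p) *ᵥ r) := by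
    intro p
    induction p using Polynomial.induction_on' with
    | add p q hp hq => simp only [map_add, Matrix.add_mulVec, hp, hq, Matrix.mulVec_add]
    | monomial j a =>
      simp only [aeval_monomial, Algebra.algebraMap_eq_smul_one, smul_mul_assoc, one_mul,
        Matrix.smul_mulVec, h, Matrix.mulVec_smul]
  have h1 := hp R.charpoly
  rw [Matrix.aeval_self_charpoly, Matrix.zero_mulVec, Matrix.mulVec_zero] at h1
  -- The value is a product of factors A - μ with μ running over the roots of the characteristic
  -- polynomial of R; a singular factor would be a common eigenvalue.
  have hu : IsUnit (aeval A R.charpoly) := by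
    by_contra hu
    have hs : R.charpoly = (Multiset.map (fun x : ℂ => X - C x) R.charpoly.roots).prod := by
      have := (IsAlgClosed.splits R.charpoly).eq_prod_roots
      rwa [R.charpoly_monic.leadingCoeff, C_1, one_mul] at this
    rw [hs] at hu
    obtain ⟨μ, hμ, h2⟩ := spectrum.exists_mem_of_not_isUnit_aeval_prod hu
    have conv : ∀ {l : ℕ} {B : Matrix (Fin l) (Fin l) ℂ}, μ ∈ spectrum ℂ B →
        IsEigenvalue B μ := by
      intro l B hB
      rwa [IsEigenvalue, Module.End.hasEigenvalue_iff_mem_spectrum, Matrix.spectrum_toLin']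
    exact hd μ (conv hμ) (conv (Matrix.mem_spectrum_iff_isRoot_charpoly.2 h2))
  exact Matrix.mulVec_injective_of_isUnit hu (by rw [h1, Matrix.mulVec_zero])

/-! ### Analyticity of inverses and behaviour at infinity. -/

section Analytic

attribute [local instance] Matrix.linftyOpNormedRing Matrix.linftyOpNormedAlgebra

theorem differentiableAt_inv_apply {k : ℕ} {M : ℂ → Matrix (Fin k) (Fin k) ℂ} {z : ℂ}
    (hM : ∀ i j, DifferentiableAt ℂ (fun w => M w i j) z) (hu : IsUnit (M z)) (i j : Fin k) :
    DifferentiableAt ℂ (fun w => (M w)⁻¹ i j) z := by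
  have h1 : DifferentiableAt ℂ M z :=
    differentiableAt_pi.2 fun i => differentiableAt_pi.2 fun j => hM i j
  have h2 : DifferentiableAt ℂ (fun w => (M w)⁻¹) z := by
    simp only [Matrix.nonsing_inv_eq_ringInverse]
    exact (differentiableAt_inverse hu).comp z h1
  exact differentiableAt_pi.1 (differentiableAt_pi.1 h2 i) j

theorem tendsto_resolvent {k : ℕ} (A : Matrix (Fin k) (Fin k) ℂ) :
    Filter.Tendsto (fun s : ℂ => (s • (1 : Matrix (Fin k) (Fin k) ℂ) - A)⁻¹)
      (Bornology.cobounded ℂ) (nhds 0) := by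
  have h := spectrum.resolvent_tendsto_cobounded (𝕜 := ℂ) A
  refine h.congr fun s => ?_
  rw [resolvent, Matrix.nonsing_inv_eq_ringInverse, Algebra.algebraMap_eq_smul_one]

end Analytic

theorem tendsto_transfer {n m : ℕ} (M : Model ℂ n m) :
    Filter.Tendsto M.transfer (Bornology.cobounded ℂ) (nhds M.D) := by
  have h1 : Continuous fun N : Matrix (Fin n) (Fin n) ℂ => M.C * N * M.B + M.D := by fun_prop
  have h2 := (h1.tendsto 0).comp (tendsto_resolvent M.A)
  simpa [Function.comp_def, Model.transfer] using! h2

end PassiveLTI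

/-! ### The Lyapunov identity of a deflating subspace. -/

namespace PassiveLTI

variable {n m k : ℕ}

/-- The coefficients of the deflating subspace equation of the complex system pencil. -/
structure Model.Deflates (M : Model ℂ n m) (U V : Matrix (Fin n) (Fin k) ℂ)
    (W : Matrix (Fin m) (Fin k) ℂ) (R : Matrix (Fin k) (Fin k) ℂ) : Prop where
  state : M.A * V + M.B * W = V * R
  costate : M.Aᴴ * U + M.Cᴴ * W = -(U * R)
  output : M.Bᴴ * U + M.C * V + (M.Dᴴ + M.D) * W = 0

namespace Model.Deflates

variable {M : Model ℂ n m} {U V : Matrix (Fin n) (Fin k) ℂ} {W : Matrix (Fin m) (Fin k) ℂ}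
  {R : Matrix (Fin k) (Fin k) ℂ}

theorem costate_conjTranspose (h : M.Deflates U V W R) :
    Uᴴ * M.A + Wᴴ * M.C = -(Rᴴ * Uᴴ) := by
  have := congrArg Matrix.conjTranspose h.costate
  simpa [Matrix.conjTranspose_add, Matrix.conjTranspose_mul, Matrix.conjTranspose_neg] using this

theorem output_conjTranspose (h : M.Deflates U V W R) :
    Uᴴ * M.B + Vᴴ * M.Cᴴ + Wᴴ * (M.Dᴴ + M.D) = 0 := by
  have := congrArg Matrix.conjTranspose h.output
  rw [add_comm M.Dᴴ M.D]
  simpa [Matrix.conjTranspose_add, Matrix.conjTranspose_mul] using this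

theorem sylvester (h : M.Deflates U V W R) :
    (Uᴴ * V) * R + Rᴴ * (Uᴴ * V) = Uᴴ * M.B * W - Wᴴ * M.C * V := by
  have h1 := congrArg (Uᴴ * ·) h.state
  have h2 := congrArg (· * V) h.costate_conjTranspose
  simp only [Matrix.mul_add, Matrix.add_mul, Matrix.neg_mul] at h1 h2
  simp only [Matrix.mul_assoc] at h1 h2 ⊢
  rw [← h1, ← neg_eq_iff_eq_neg.2 h2]
  abel

/-- Energy balance: the left side is the derivative of the storage -UᴴV along the flow of R, the
right side twice the Hermitian part of the supply Wᴴ(CV + DW). The output equation removes U from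
the supply. -/
theorem lyapunov (h : M.Deflates U V W R) :
    (-(Uᴴ * V)) * R + Rᴴ * (-(Uᴴ * V)) =
      Wᴴ * (M.C * V + M.D * W) + (M.C * V + M.D * W)ᴴ * W := by
  have h3 := congrArg (· * W) h.output_conjTranspose
  simp only [Matrix.mul_add, Matrix.add_mul, Matrix.zero_mul] at h3
  rw [Matrix.neg_mul, Matrix.mul_neg, ← neg_add, h.sylvester]
  simp only [Matrix.conjTranspose_add, Matrix.conjTranspose_mul, Matrix.mul_add, Matrix.add_mul,
    Matrix.mul_assoc] at h3 ⊢
  rw [neg_sub, ← sub_eq_zero, ← neg_eq_zero, ← h3]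
  abel

/-- The right side of the Lyapunov identity is Hermitian, so the skew part K of UᴴV satisfies -RᴴK =
KR. The spectra of -Rᴴ and R lie in opposite half planes, which leaves only K = 0. -/
theorem isHermitian (h : M.Deflates U V W R) (hR : ∀ μ, IsEigenvalue R μ → 0 < μ.re) :
    (Uᴴ * V).IsHermitian := by
  set K := Uᴴ * V - (Uᴴ * V)ᴴ with hK
  have h1 : -Rᴴ * K = K * R := by
    have hs : ((Uᴴ * V) * R + Rᴴ * (Uᴴ * V))ᴴ = (Uᴴ * V) * R + Rᴴ * (Uᴴ * V) := by
      have h0 := h.lyapunov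
      have h2 : (Uᴴ * V) * R + Rᴴ * (Uᴴ * V) =
          -(Wᴴ * (M.C * V + M.D * W) + (M.C * V + M.D * W)ᴴ * W) := by
        rw [← h0, Matrix.neg_mul, Matrix.mul_neg, ← neg_add, neg_neg]
      rw [h2, Matrix.conjTranspose_neg, Matrix.conjTranspose_add, Matrix.conjTranspose_mul,
        Matrix.conjTranspose_mul, Matrix.conjTranspose_conjTranspose,
        Matrix.conjTranspose_conjTranspose, add_comm]
    rw [Matrix.conjTranspose_add, Matrix.conjTranspose_mul (Uᴴ * V) R,
      Matrix.conjTranspose_mul Rᴴ (Uᴴ * V), Matrix.conjTranspose_conjTranspose R] at hs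
    rw [hK, Matrix.mul_sub, Matrix.sub_mul, ← sub_eq_zero]
    rw [← sub_eq_zero] at hs
    rw [← hs, Matrix.neg_mul, Matrix.neg_mul]
    abel
  have h2 : ∀ j : ℕ, (-Rᴴ) ^ j * K = K * R ^ j := by
    intro j
    induction j with
    | zero => simp
    | succ j ih => rw [pow_succ, Matrix.mul_assoc, h1, ← Matrix.mul_assoc, ih, Matrix.mul_assoc,
        pow_succ]
  have h3 : ∀ r, K *ᵥ r = 0 := fun r =>
    mulVec_eq_zero_of_intertwine (A := -Rᴴ) (R := R)
      (fun j => by rw [Matrix.mulVec_mulVec, Matrix.mulVec_mulVec, h2])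
      (fun μ hμ hμ' => by
        have := hR _ (isEigenvalue_conjTranspose (isEigenvalue_neg hμ))
        have h4 := hR _ hμ'
        simp at this
        linarith)
  have h4 : K = 0 := Matrix.ext_of_mulVec_single fun i => by rw [h3, Matrix.zero_mulVec]
  exact (sub_eq_zero.1 h4).symm

end Model.Deflates

theorem re_star_dotProduct_conjTranspose {ι : Type} [Fintype ι] (T : Matrix ι ι ℂ) (f : ι → ℂ) :
    (star f ⬝ᵥ ((Tᴴ + T) *ᵥ f)).re = 2 * (star f ⬝ᵥ (T *ᵥ f)).re := by
  have h1 : star f ⬝ᵥ (Tᴴ *ᵥ f) = star (star f ⬝ᵥ (T *ᵥ f)) := by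
    rw [Matrix.star_dotProduct, Matrix.star_mulVec, Matrix.conjTranspose_conjTranspose,
      ← Matrix.dotProduct_mulVec]
  rw [Matrix.add_mulVec, dotProduct_add, h1, Complex.add_re, Complex.star_def, Complex.conj_re]
  ring

/-- If `W (iω - R)⁻¹ r = 0` on the imaginary axis, then `W Rʲ r = 0` for all `j`. -/
theorem mulVec_pow_mulVec_eq_zero {W : Matrix (Fin m) (Fin k) ℂ} {R : Matrix (Fin k) (Fin k) ℂ}
    (hR : ∀ ω : ℝ, ¬ IsEigenvalue R (Complex.I * ω)) (j : ℕ) (r : Fin k → ℂ)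
    (h : ∀ ω : ℝ, W *ᵥ (((Complex.I * ω) • (1 : Matrix (Fin k) (Fin k) ℂ) - R)⁻¹ *ᵥ r) = 0) :
    W *ᵥ ((R ^ j) *ᵥ r) = 0 := by
  have hcomm : ∀ ω : ℝ, ((Complex.I * ω) • (1 : Matrix (Fin k) (Fin k) ℂ) - R)⁻¹ * R =
      (Complex.I * ω) • ((Complex.I * ω) • (1 : Matrix (Fin k) (Fin k) ℂ) - R)⁻¹ - 1 := by
    intro ω
    have hu := isUnit_resolvent (hR ω)
    have h1 := Matrix.nonsing_inv_mul _ ((Matrix.isUnit_iff_isUnit_det _).1 hu)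
    rw [Matrix.mul_sub, Matrix.mul_smul, Matrix.mul_one] at h1
    nth_rw 3 [← h1]
    abel
  have h0 : ∀ r : Fin k → ℂ, (∀ ω : ℝ,
      W *ᵥ (((Complex.I * ω) • (1 : Matrix (Fin k) (Fin k) ℂ) - R)⁻¹ *ᵥ r) = 0) → W *ᵥ r = 0 := by
    -- Under the hypothesis W(iω - R)⁻¹Rr is the constant -Wr, while the resolvent tends to 0 as ω →
    -- ∞.
    intro r h
    have ht : Filter.Tendsto (fun ω : ℝ => Complex.I * ω) Filter.atTop (Bornology.cobounded ℂ) := by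
      rw [← tendsto_norm_atTop_iff_cobounded]
      simpa using Filter.tendsto_abs_atTop_atTop
    have hc : Continuous fun N : Matrix (Fin k) (Fin k) ℂ => W *ᵥ (N *ᵥ (R *ᵥ r)) := by fun_prop
    have h1 := ((hc.tendsto 0).comp (tendsto_resolvent R)).comp ht
    have h2 : ∀ ω : ℝ, W *ᵥ (((Complex.I * ω) • (1 : Matrix (Fin k) (Fin k) ℂ) - R)⁻¹ *ᵥ (R *ᵥ r))
        = -(W *ᵥ r) := by
      intro ω
      rw [Matrix.mulVec_mulVec _ _ R, hcomm, Matrix.sub_mulVec, Matrix.smul_mulVec,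
        Matrix.mulVec_sub, Matrix.mulVec_smul, h, Matrix.one_mulVec, smul_zero, zero_sub]
    simp only [Function.comp_def, h2, Matrix.zero_mulVec, Matrix.mulVec_zero] at h1
    exact neg_eq_zero.1 (tendsto_nhds_unique tendsto_const_nhds h1)
  induction j generalizing r with
  | zero => simpa using h0 r h
  | succ j ih =>
    have h2 : ∀ ω : ℝ, W *ᵥ (((Complex.I * ω) • (1 : Matrix (Fin k) (Fin k) ℂ) - R)⁻¹ *ᵥ (R *ᵥ r))
        = 0 := by
      intro ω
      rw [Matrix.mulVec_mulVec _ _ R, hcomm, Matrix.sub_mulVec, Matrix.smul_mulVec,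
        Matrix.mulVec_sub, Matrix.mulVec_smul, h, Matrix.one_mulVec, smul_zero, zero_sub, h0 r h,
        neg_zero]
    rw [pow_succ, ← Matrix.mulVec_mulVec]
    exact ih (R *ᵥ r) h2

end PassiveLTI

/-! ### The energy identity on the unit circle. -/

namespace PassiveLTI

variable {n m k : ℕ} {M : Model ℂ n m} {U V : Matrix (Fin n) (Fin k) ℂ}
  {W : Matrix (Fin m) (Fin k) ℂ} {R : Matrix (Fin k) (Fin k) ℂ}

theorem star_mulVec_dotProduct {a b : ℕ} (N : Matrix (Fin a) (Fin b) ℂ) (u : Fin b → ℂ)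
    (v : Fin a → ℂ) : star (N *ᵥ u) ⬝ᵥ v = star u ⬝ᵥ (Nᴴ *ᵥ v) := by
  rw [Matrix.star_mulVec, Matrix.dotProduct_mulVec]

theorem star_dotProduct_comm {a : ℕ} (u v : Fin a → ℂ) :
    star u ⬝ᵥ v = starRingEnd ℂ (star v ⬝ᵥ u) := by
  rw [Matrix.star_dotProduct, Complex.star_def]

/-- Here Wg is the transformed input and l accounts for the free response after time 0. The Lyapunov
identity turns the supply into 2 Re(gᴴXRg); expressing it through r by means of |z| = 1 separates a
constant from z times an expression linear in g. -/
theorem Model.Deflates.circle_identity (h : M.Deflates U V W R) (hX : (Uᴴ * V).IsHermitian)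
    {z : ℂ} (hz : ‖z‖ = 1) {r g : Fin k → ℂ} {l : Fin n → ℂ}
    (hg : (z - 1) • g - (z + 1) • (R *ᵥ g) = r) {T : Matrix (Fin m) (Fin m) ℂ}
    (hT : T *ᵥ (W *ᵥ g) = (M.C * V + M.D * W) *ᵥ g - M.C *ᵥ l) :
    (star (W *ᵥ g) ⬝ᵥ ((Tᴴ + T) *ᵥ (W *ᵥ g))).re =
      (star r ⬝ᵥ (-(Uᴴ * V) *ᵥ r)).re / 2
        - (z * (star r ⬝ᵥ (-(Uᴴ * V) *ᵥ (g - R *ᵥ g)))).re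
        - 2 * (star (W *ᵥ g) ⬝ᵥ (M.C *ᵥ l)).re := by
  set X := -(Uᴴ * V) with hXdef
  have hXh : Xᴴ = X := by rw [hXdef, Matrix.conjTranspose_neg, hX.eq]
  have h1 : 2 * (star (W *ᵥ g) ⬝ᵥ ((M.C * V + M.D * W) *ᵥ g)).re =
      2 * (star g ⬝ᵥ (X *ᵥ (R *ᵥ g))).re := by
    rw [star_mulVec_dotProduct, Matrix.mulVec_mulVec, Matrix.mulVec_mulVec,
      ← re_star_dotProduct_conjTranspose, ← re_star_dotProduct_conjTranspose,
      Matrix.conjTranspose_mul X R, hXh, Matrix.conjTranspose_mul, Matrix.conjTranspose_conjTranspose,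
      add_comm, ← h.lyapunov, add_comm]
  rw [re_star_dotProduct_conjTranspose, hT, dotProduct_sub, Complex.sub_re, mul_sub, h1]
  congr 1
  set p := R *ᵥ g with hp
  have hgp : star p ⬝ᵥ (X *ᵥ g) = starRingEnd ℂ (star g ⬝ᵥ (X *ᵥ p)) := by
    rw [star_dotProduct_comm, star_mulVec_dotProduct, hXh]
  have hgg : star g ⬝ᵥ (X *ᵥ g) = starRingEnd ℂ (star g ⬝ᵥ (X *ᵥ g)) := by
    conv_lhs => rw [star_dotProduct_comm, star_mulVec_dotProduct, hXh]
  have hpp : star p ⬝ᵥ (X *ᵥ p) = starRingEnd ℂ (star p ⬝ᵥ (X *ᵥ p)) := by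
    conv_lhs => rw [star_dotProduct_comm, star_mulVec_dotProduct, hXh]
  rw [← hg]
  simp only [star_sub, star_smul, Matrix.mulVec_sub, Matrix.mulVec_smul, sub_dotProduct,
    dotProduct_sub, smul_dotProduct, dotProduct_smul, hgp, smul_eq_mul]
  generalize star g ⬝ᵥ (X *ᵥ p) = β at *
  generalize star g ⬝ᵥ (X *ᵥ g) = α at *
  generalize star p ⬝ᵥ (X *ᵥ p) = γ at *
  have hz2 : z.re * z.re + z.im * z.im = 1 := by
    rw [← Complex.normSq_apply, Complex.normSq_eq_norm_sq, hz, one_pow]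
  have ha : α.im = 0 := Complex.conj_eq_iff_im.1 hgg.symm
  have hc : γ.im = 0 := Complex.conj_eq_iff_im.1 hpp.symm
  simp only [Complex.sub_re, Complex.mul_re, Complex.sub_im, Complex.mul_im, Complex.add_re,
    Complex.add_im, Complex.star_def, Complex.conj_re, Complex.conj_im, Complex.one_re,
    Complex.one_im, ha, hc]
  ring_nf
  have hz3 : z.im ^ 2 = 1 - z.re ^ 2 := by linear_combination hz2
  rw [hz3]
  ring

/-- The Cayley map sends the disc into the closed left half plane; at z = -1 the convention x / 0 =
0 keeps the bound true. -/
theorem re_cayley_nonpos {z : ℂ} (hz : ‖z‖ ≤ 1) : ((z - 1) / (z + 1)).re ≤ 0 := by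
  have h1 : z.re * z.re + z.im * z.im ≤ 1 := by
    rw [← Complex.normSq_apply, Complex.normSq_eq_norm_sq]
    exact pow_le_one₀ (norm_nonneg _) hz
  rw [Complex.div_re, ← add_div]
  refine div_nonpos_of_nonpos_of_nonneg ?_ (Complex.normSq_nonneg _)
  simp
  nlinarith

theorem re_cayley_eq_zero {z : ℂ} (hz : ‖z‖ = 1) : ((z - 1) / (z + 1)).re = 0 := by
  have h1 : z.re * z.re + z.im * z.im = 1 := by
    rw [← Complex.normSq_apply, Complex.normSq_eq_norm_sq, hz, one_pow]
  rw [Complex.div_re, ← add_div, div_eq_zero_iff]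
  left
  simp
  linear_combination h1

/-- The analytic part of the energy of the trajectory generated by `r`, transplanted to the
unit disc. -/
noncomputable def energyDisc (M : Model ℂ n m) (X : Matrix (Fin k) (Fin k) ℂ)
    (V : Matrix (Fin n) (Fin k) ℂ) (W : Matrix (Fin m) (Fin k) ℂ) (R : Matrix (Fin k) (Fin k) ℂ)
    (r : Fin k → ℂ) (z : ℂ) : ℂ :=
  star r ⬝ᵥ (X *ᵥ (((1 - R) * ((z - 1) • (1 : Matrix (Fin k) (Fin k) ℂ) - (z + 1) • R)⁻¹) *ᵥ r)) +
  2 * (star (V *ᵥ r) ⬝ᵥ (((-(z - 1)) • (1 : Matrix (Fin n) (Fin n) ℂ) - (z + 1) • M.Aᴴ)⁻¹ *ᵥ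
    (M.Cᴴ *ᵥ (W *ᵥ (((z - 1) • (1 : Matrix (Fin k) (Fin k) ℂ) - (z + 1) • R)⁻¹ *ᵥ r)))))

theorem isUnit_cayley_antistable (hR : ∀ μ, IsEigenvalue R μ → 0 < μ.re) {z : ℂ} (hz : ‖z‖ ≤ 1) :
    IsUnit ((z - 1) • (1 : Matrix (Fin k) (Fin k) ℂ) - (z + 1) • R) := by
  refine isUnit_smul_one_sub_smul (fun h0 h1 => ?_) fun _ he => ?_
  · exact two_ne_zero (α := ℂ) (by linear_combination h0 - h1)
  · exact absurd (re_cayley_nonpos hz) (not_le.2 (hR _ he))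

theorem isUnit_cayley_stable_conjTranspose {A : Matrix (Fin n) (Fin n) ℂ}
    (hA : ∀ μ, IsEigenvalue A μ → μ.re < 0) {z : ℂ} (hz : ‖z‖ ≤ 1) :
    IsUnit ((-(z - 1)) • (1 : Matrix (Fin n) (Fin n) ℂ) - (z + 1) • Aᴴ) := by
  refine isUnit_smul_one_sub_smul (fun h0 h1 => ?_) fun _ he => ?_
  · exact two_ne_zero (α := ℂ) (by linear_combination h0 + h1)
  · have h1 := hA _ (isEigenvalue_conjTranspose he)
    have h2 := re_cayley_nonpos hz
    rw [Complex.conj_re, neg_div, Complex.neg_re] at h1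
    linarith

theorem isUnit_cayley_stable {A : Matrix (Fin n) (Fin n) ℂ}
    (hA : ∀ μ, IsEigenvalue A μ → μ.re < 0) {z : ℂ} (hz : ‖z‖ = 1) :
    IsUnit ((z - 1) • (1 : Matrix (Fin n) (Fin n) ℂ) - (z + 1) • A) := by
  refine isUnit_smul_one_sub_smul (fun h0 h1 => ?_) fun _ he => ?_
  · exact two_ne_zero (α := ℂ) (by linear_combination h0 - h1)
  · exact absurd (re_cayley_eq_zero hz) (hA _ he).ne

theorem differentiableAt_bilinear {K : ℂ → Matrix (Fin k) (Fin k) ℂ}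
    {L : ℂ → Matrix (Fin n) (Fin n) ℂ} {z : ℂ}
    (hK : ∀ i j, DifferentiableAt ℂ (fun w => K w i j) z)
    (hL : ∀ i j, DifferentiableAt ℂ (fun w => L w i j) z) (u : Fin k → ℂ) (v : Fin n → ℂ)
    (X Y : Matrix (Fin k) (Fin k) ℂ) (C : Matrix (Fin n) (Fin m) ℂ) (W : Matrix (Fin m) (Fin k) ℂ)
    (r : Fin k → ℂ) :
    DifferentiableAt ℂ (fun w => u ⬝ᵥ (X *ᵥ ((Y * K w) *ᵥ r)) +
      2 * (v ⬝ᵥ (L w *ᵥ (C *ᵥ (W *ᵥ (K w *ᵥ r)))))) z := by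
  simp only [Matrix.mulVec, dotProduct, Matrix.mul_apply]
  fun_prop

theorem differentiableAt_energyDisc (hA : ∀ μ, IsEigenvalue M.A μ → μ.re < 0)
    (hR : ∀ μ, IsEigenvalue R μ → 0 < μ.re) (X : Matrix (Fin k) (Fin k) ℂ) (r : Fin k → ℂ)
    {z : ℂ} (hz : ‖z‖ ≤ 1) : DifferentiableAt ℂ (energyDisc M X V W R r) z := by
  have h1 := fun i j => differentiableAt_inv_apply
    (M := fun z : ℂ => (z - 1) • (1 : Matrix (Fin k) (Fin k) ℂ) - (z + 1) • R) (z := z)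
    (fun i j => by simp only [Matrix.sub_apply, Matrix.smul_apply]; fun_prop)
    (isUnit_cayley_antistable hR hz) i j
  have h2 := fun i j => differentiableAt_inv_apply
    (M := fun z : ℂ => (-(z - 1)) • (1 : Matrix (Fin n) (Fin n) ℂ) - (z + 1) • M.Aᴴ) (z := z)
    (fun i j => by simp only [Matrix.sub_apply, Matrix.smul_apply]; fun_prop)
    (isUnit_cayley_stable_conjTranspose hA hz) i j
  exact differentiableAt_bilinear h1 h2 (star r) (star (V *ᵥ r)) X (1 - R) M.Cᴴ W r

/-- Only the tail term with l is not analytic in z after conjugation. On the circle the conjugate of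
z is 1/z, so the adjoint of ((z-1) - (z+1)A)⁻¹ is z(-(z-1) - (z+1)Aᴴ)⁻¹, whose second factor is
analytic on the closed disc because A is stable. The case z = -1 is s = ∞, where the transfer
function is replaced by its limit D. -/
theorem Model.Deflates.popov_eq_energyDisc (h : M.Deflates U V W R)
    (hA : ∀ μ, IsEigenvalue M.A μ → μ.re < 0) (hR : ∀ μ, IsEigenvalue R μ → 0 < μ.re)
    {z : ℂ} (hz : ‖z‖ = 1) (r : Fin k → ℂ) {g : Fin k → ℂ}
    (hg : g = ((z - 1) • (1 : Matrix (Fin k) (Fin k) ℂ) - (z + 1) • R)⁻¹ *ᵥ r)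
    {T : Matrix (Fin m) (Fin m) ℂ}
    (hT : (z + 1 = 0 ∧ T = M.D) ∨ (z + 1 ≠ 0 ∧ T = M.transfer ((z - 1) / (z + 1)))) :
    (star (W *ᵥ g) ⬝ᵥ ((Tᴴ + T) *ᵥ (W *ᵥ g))).re =
      (star r ⬝ᵥ (-(Uᴴ * V) *ᵥ r)).re / 2 - (z * energyDisc M (-(Uᴴ * V)) V W R r z).re := by
  have hu := (Matrix.isUnit_iff_isUnit_det _).1 (isUnit_cayley_antistable hR hz.le)
  have hl := (Matrix.isUnit_iff_isUnit_det _).1 (isUnit_cayley_stable hA hz)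
  have hs := (Matrix.isUnit_iff_isUnit_det _).1 (isUnit_cayley_stable_conjTranspose hA hz.le)
  set l := ((z - 1) • (1 : Matrix (Fin n) (Fin n) ℂ) - (z + 1) • M.A)⁻¹ *ᵥ (V *ᵥ r) with hldef
  have hg' : (z - 1) • g - (z + 1) • (R *ᵥ g) = r := by
    have : ((z - 1) • (1 : Matrix (Fin k) (Fin k) ℂ) - (z + 1) • R) *ᵥ g = r := by
      rw [hg, Matrix.mulVec_mulVec, Matrix.mul_nonsing_inv _ hu, Matrix.one_mulVec]
    simpa only [Matrix.sub_mulVec, Matrix.smul_mulVec, Matrix.one_mulVec] using this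
  have hl' : (z - 1) • l - (z + 1) • (M.A *ᵥ l) = V *ᵥ r := by
    have : ((z - 1) • (1 : Matrix (Fin n) (Fin n) ℂ) - (z + 1) • M.A) *ᵥ l = V *ᵥ r := by
      rw [hldef, Matrix.mulVec_mulVec, Matrix.mul_nonsing_inv _ hl, Matrix.one_mulVec]
    simpa only [Matrix.sub_mulVec, Matrix.smul_mulVec, Matrix.one_mulVec] using this
  have hst : M.A *ᵥ (V *ᵥ g) + M.B *ᵥ (W *ᵥ g) = V *ᵥ (R *ᵥ g) := by
    simp only [Matrix.mulVec_mulVec, ← Matrix.add_mulVec, h.state]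
  have hVr : V *ᵥ r = (z - 1) • (V *ᵥ g) - (z + 1) • (M.A *ᵥ (V *ᵥ g) + M.B *ᵥ (W *ᵥ g)) := by
    rw [hst, ← hg', Matrix.mulVec_sub, Matrix.mulVec_smul, Matrix.mulVec_smul]
  have hT' : T *ᵥ (W *ᵥ g) = (M.C * V + M.D * W) *ᵥ g - M.C *ᵥ l := by
    rcases hT with ⟨hb, rfl⟩ | ⟨hb, rfl⟩
    · have ha : z - 1 ≠ 0 := fun ha => two_ne_zero (α := ℂ) (by linear_combination hb - ha)
      have : V *ᵥ g = l := by
        rw [hb, zero_smul, sub_zero] at hl' hVr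
        rw [hVr] at hl'
        exact (smul_right_injective _ ha hl').symm
      rw [Matrix.add_mulVec, ← Matrix.mulVec_mulVec, ← Matrix.mulVec_mulVec, this]
      abel
    · have hnot : ¬ IsEigenvalue M.A ((z - 1) / (z + 1)) :=
        fun he => absurd (re_cayley_eq_zero hz) (hA _ he).ne
      have hr := (Matrix.isUnit_iff_isUnit_det _).1 (isUnit_resolvent hnot)
      have h1 : (((z - 1) / (z + 1)) • (1 : Matrix (Fin n) (Fin n) ℂ) - M.A) *ᵥ (V *ᵥ g - l) =
          M.B *ᵥ (W *ᵥ g) := by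
        refine smul_right_injective _ hb ?_
        simp only [Matrix.sub_mulVec, Matrix.smul_mulVec, Matrix.one_mulVec, Matrix.mulVec_sub,
          smul_sub, smul_smul, mul_div_cancel₀ _ hb]
        linear_combination (norm := module) -hl' - hVr
      have h2 : (((z - 1) / (z + 1)) • (1 : Matrix (Fin n) (Fin n) ℂ) - M.A)⁻¹ *ᵥ
          (M.B *ᵥ (W *ᵥ g)) = V *ᵥ g - l := by
        rw [← h1, Matrix.mulVec_mulVec, Matrix.nonsing_inv_mul _ hr, Matrix.one_mulVec]
      rw [Model.transfer, Matrix.add_mulVec, ← Matrix.mulVec_mulVec, ← Matrix.mulVec_mulVec, h2,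
        Matrix.add_mulVec, ← Matrix.mulVec_mulVec, ← Matrix.mulVec_mulVec, Matrix.mulVec_sub]
      abel
  rw [h.circle_identity (h.isHermitian hR) hz hg' hT', energyDisc, ← Matrix.mulVec_mulVec, ← hg,
    Matrix.sub_mulVec, Matrix.one_mulVec]
  have hconj : starRingEnd ℂ z * z = 1 := by
    rw [mul_comm, Complex.mul_conj, Complex.normSq_eq_norm_sq, hz]; norm_num
  -- Replaces the antianalytic resolvent hidden in lᴴ by z times an analytic one.
  have hy : ∀ w, star l ⬝ᵥ w = z * (star (V *ᵥ r) ⬝ᵥ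
      (((-(z - 1)) • (1 : Matrix (Fin n) (Fin n) ℂ) - (z + 1) • M.Aᴴ)⁻¹ *ᵥ w)) := by
    intro w
    set y := ((-(z - 1)) • (1 : Matrix (Fin n) (Fin n) ℂ) - (z + 1) • M.Aᴴ)⁻¹ *ᵥ w with hydef
    have hy' : (-(z - 1)) • y - (z + 1) • (M.Aᴴ *ᵥ y) = w := by
      have : ((-(z - 1)) • (1 : Matrix (Fin n) (Fin n) ℂ) - (z + 1) • M.Aᴴ) *ᵥ y = w := by
        rw [hydef, Matrix.mulVec_mulVec, Matrix.mul_nonsing_inv _ hs, Matrix.one_mulVec]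
      simpa only [Matrix.sub_mulVec, Matrix.smul_mulVec, Matrix.one_mulVec] using this
    rw [← hl', ← hy']
    simp only [star_sub, star_smul, sub_dotProduct, dotProduct_sub, smul_dotProduct,
      dotProduct_smul, star_mulVec_dotProduct, smul_eq_mul, star_add, Complex.star_def, map_one]
    linear_combination (-(star l ⬝ᵥ y) + (star l ⬝ᵥ (M.Aᴴ *ᵥ y))) * hconj
  have hre : (star (W *ᵥ g) ⬝ᵥ (M.C *ᵥ l)).re = (star l ⬝ᵥ (M.Cᴴ *ᵥ (W *ᵥ g))).re := by
    rw [star_dotProduct_comm, Complex.conj_re, star_mulVec_dotProduct]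
  rw [hre, hy, mul_add, Complex.add_re, mul_left_comm z 2, ← sub_sub]
  congr 1
  simp [Complex.mul_re]

end PassiveLTI

/-! ### Maximum principles and dissipation. -/

namespace PassiveLTI

variable {n m k : ℕ} {M : Model ℂ n m} {U V : Matrix (Fin n) (Fin k) ℂ}
  {W : Matrix (Fin m) (Fin k) ℂ} {R : Matrix (Fin k) (Fin k) ℂ}

/-- If an analytic `F` on the disc satisfies `Re (z F(z)) ≤ c` on the circle, then `c ≥ 0`, with
equality only if `Re (z F(z)) = 0` on the circle. -/
theorem nonneg_of_re_mul_le_on_circle {F : ℂ → ℂ} (hF : ∀ z, ‖z‖ ≤ 1 → DifferentiableAt ℂ F z)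
    {c : ℝ} (hc : ∀ z, ‖z‖ = 1 → (z * F z).re ≤ c) :
    0 ≤ c ∧ (c = 0 → ∀ z, ‖z‖ = 1 → (z * F z).re = 0) := by
  -- |f| = exp(Re(zF)) and f(0) = 1, so the maximum modulus principle bounds the real part; equality
  -- puts an interior maximum at 0 and makes |f| constant.
  set f : ℂ → ℂ := fun z => Complex.exp (z * F z) with hf
  have hd : DiffContOnCl ℂ f (Metric.ball 0 1) := by
    refine DifferentiableOn.diffContOnCl fun z hz => ?_
    rw [closure_ball _ one_ne_zero, mem_closedBall_zero_iff] at hz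
    exact ((differentiableAt_id.mul (hF z hz)).cexp).differentiableWithinAt
  have hn : ∀ z, ‖f z‖ = Real.exp (z * F z).re := fun z => Complex.norm_exp _
  have hle : ∀ z ∈ closure (Metric.ball (0 : ℂ) 1), ‖f z‖ ≤ Real.exp c := fun z hz =>
    Complex.norm_le_of_forall_mem_frontier_norm_le Metric.isBounded_ball hd (fun w hw => by
      rw [frontier_ball _ one_ne_zero, mem_sphere_zero_iff_norm] at hw
      rw [hn]
      exact Real.exp_le_exp.2 (hc w hw)) hz
  have h0 : (0 : ℂ) ∈ Metric.ball (0 : ℂ) 1 := Metric.mem_ball_self one_pos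
  have hf0 : ‖f 0‖ = 1 := by rw [hn]; simp
  refine ⟨?_, fun hc0 z hz => ?_⟩
  · have := hle 0 (subset_closure h0)
    rw [hf0] at this
    exact Real.one_le_exp_iff.1 this
  · have hm : IsMaxOn (norm ∘ f) (Metric.ball 0 1) 0 := fun w hw => by
      have := hle w (subset_closure hw)
      rw [hc0, Real.exp_zero] at this
      simpa [hf0] using this
    have h1 := Complex.norm_eqOn_closure_of_isPreconnected_of_isMaxOn
      (convex_ball (0 : ℂ) 1).isPreconnected Metric.isOpen_ball hd h0 hm
      (x := z) (by rw [closure_ball _ one_ne_zero, mem_closedBall_zero_iff]; exact hz.le)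
    simp only [Function.comp_apply, Function.const_apply, hf0, hn] at h1
    exact Real.exp_eq_one_iff _ |>.1 h1

theorem re_nonneg_of_posSemidef {ι : Type} [Fintype ι] {N : Matrix ι ι ℂ}
    (h : N.PosSemidef) (x : ι → ℂ) : 0 ≤ (star x ⬝ᵥ (N *ᵥ x)).re :=
  (Complex.le_def.1 (h.dotProduct_mulVec_nonneg x)).1

theorem eq_zero_of_posDef {ι : Type} [Fintype ι] {N : Matrix ι ι ℂ}
    (h : N.PosDef) {x : ι → ℂ} (hx : (star x ⬝ᵥ (N *ᵥ x)).re = 0) : x = 0 := by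
  by_contra h0
  exact absurd hx (Complex.lt_def.1 (h.dotProduct_mulVec_pos h0)).1.ne'

/-- Dissipation: the storage matrix `-UᴴV` is non-negative, and its isotropic vectors generate
trajectories with zero input. -/
theorem Model.Deflates.storage_nonneg (h : M.Deflates U V W R)
    (hA : ∀ μ, IsEigenvalue M.A μ → μ.re < 0) (hR : ∀ μ, IsEigenvalue R μ → 0 < μ.re)
    (hP : ∀ ω : ℝ, (M.popov (Complex.I * ω)).PosDef) (hD : (M.Dᴴ + M.D).PosSemidef)
    (r : Fin k → ℂ) :
    0 ≤ (star r ⬝ᵥ (-(Uᴴ * V) *ᵥ r)).re ∧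
      ((star r ⬝ᵥ (-(Uᴴ * V) *ᵥ r)).re = 0 → ∀ j : ℕ, W *ᵥ ((R ^ j) *ᵥ r) = 0) := by
  have haxis : ∀ z : ℂ, ‖z‖ = 1 → (z - 1) / (z + 1) =
      Complex.I * (((z - 1) / (z + 1)).im : ℝ) := fun z hz =>
    Complex.ext (by simpa using re_cayley_eq_zero hz) (by simp)
  have hP' : ∀ z : ℂ, ‖z‖ = 1 → ((M.transfer ((z - 1) / (z + 1)))ᴴ +
      M.transfer ((z - 1) / (z + 1))).PosDef := fun z hz => by
    have := hP ((z - 1) / (z + 1)).im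
    rwa [popov_axis, ← haxis z hz] at this
  have hc : ∀ z : ℂ, ‖z‖ = 1 → (z * energyDisc M (-(Uᴴ * V)) V W R r z).re ≤
      (star r ⬝ᵥ (-(Uᴴ * V) *ᵥ r)).re / 2 := by
    intro z hz
    by_cases hb : z + 1 = 0
    · have := h.popov_eq_energyDisc hA hR hz r rfl (Or.inl ⟨hb, rfl⟩)
      have h2 := re_nonneg_of_posSemidef hD
        (W *ᵥ (((z - 1) • (1 : Matrix (Fin k) (Fin k) ℂ) - (z + 1) • R)⁻¹ *ᵥ r))
      linarith
    · have := h.popov_eq_energyDisc hA hR hz r rfl (Or.inr ⟨hb, rfl⟩)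
      have h2 := re_nonneg_of_posSemidef (hP' z hz).posSemidef
        (W *ᵥ (((z - 1) • (1 : Matrix (Fin k) (Fin k) ℂ) - (z + 1) • R)⁻¹ *ᵥ r))
      linarith
  obtain ⟨h1, h2⟩ := nonneg_of_re_mul_le_on_circle
    (fun z hz => differentiableAt_energyDisc (V := V) (W := W) hA hR (-(Uᴴ * V)) r hz) hc
  refine ⟨by linarith, fun h0 j => ?_⟩
  have hnR : ∀ ω : ℝ, ¬ IsEigenvalue R (Complex.I * ω) := fun ω he => by
    have := hR _ he
    simp at this
  refine mulVec_pow_mulVec_eq_zero hnR j r fun ω => ?_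
  have hs1 : (1 : ℂ) - Complex.I * ω ≠ 0 := fun h => by
    have := congrArg Complex.re h
    simp at this
  -- The inverse Cayley image of iω; these z exhaust the circle except -1.
  set z : ℂ := (1 + Complex.I * ω) / (1 - Complex.I * ω) with hzdef
  have hz : ‖z‖ = 1 := by
    have h3 : (1 : ℂ) + Complex.I * ω = starRingEnd ℂ (1 - Complex.I * ω) := by simp
    rw [hzdef, norm_div, h3, Complex.norm_conj, div_self (norm_ne_zero_iff.2 hs1)]
  have hb : z + 1 = 2 / (1 - Complex.I * ω) := by rw [hzdef]; field_simp; ring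
  have hb0 : z + 1 ≠ 0 := by rw [hb]; exact div_ne_zero two_ne_zero hs1
  have ha : z - 1 = (z + 1) * (Complex.I * ω) := by rw [hb, hzdef]; field_simp; ring
  have h3 := h.popov_eq_energyDisc hA hR hz r rfl (Or.inr ⟨hb0, rfl⟩)
  rw [h2 (by linarith) z hz, h0, zero_div, sub_zero] at h3
  have h4 := eq_zero_of_posDef (hP' z hz) h3
  have hu := isUnit_resolvent (hnR ω)
  have h5 : ((z - 1) • (1 : Matrix (Fin k) (Fin k) ℂ) - (z + 1) • R) =
      (Units.mk0 _ hb0) • ((Complex.I * ω) • (1 : Matrix (Fin k) (Fin k) ℂ) - R) := by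
    rw [Units.smul_def, Units.val_mk0, smul_sub, smul_smul, ha]
  rw [h5, Matrix.inv_smul' _ _ ((Matrix.isUnit_iff_isUnit_det _).1 hu), Units.smul_def,
    Matrix.smul_mulVec, Matrix.mulVec_smul] at h4
  exact (smul_eq_zero.1 h4).resolve_left (Units.ne_zero _)

theorem differentiableAt_dotProduct_affine {K : ℂ → Matrix (Fin n) (Fin n) ℂ} {s : ℂ}
    (hK : ∀ i j, DifferentiableAt ℂ (fun w => K w i j) s) (u x : Fin m → ℂ)
    (B : Matrix (Fin n) (Fin m) ℂ) (C : Matrix (Fin m) (Fin n) ℂ) (D : Matrix (Fin m) (Fin m) ℂ) :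
    DifferentiableAt ℂ (fun w => u ⬝ᵥ ((C * K w * B + D) *ᵥ x)) s := by
  simp only [Matrix.mulVec, dotProduct, Matrix.add_apply, Matrix.mul_apply]
  fun_prop

/-- The Hermitian part of the transfer function of a stable model is non-negative in the closed
right half plane if it is on the imaginary axis. -/
theorem re_transfer_nonneg (hA : ∀ μ, IsEigenvalue M.A μ → μ.re < 0)
    (hP : ∀ ω : ℝ, (M.popov (Complex.I * ω)).PosSemidef) {s : ℂ} (hs : 0 ≤ s.re)
    (x : Fin m → ℂ) : 0 ≤ (star x ⬝ᵥ (M.transfer s *ᵥ x)).re := by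
  set q : ℂ → ℂ := fun s => star x ⬝ᵥ (M.transfer s *ᵥ x) with hq
  set f : ℂ → ℂ := fun s => Complex.exp (-q s) with hf
  have hn : ∀ s, ‖f s‖ = Real.exp (-(q s).re) := fun s => by
    rw [hf, Complex.norm_exp, Complex.neg_re]
  have hd : ∀ s : ℂ, 0 ≤ s.re → DifferentiableAt ℂ f s := by
    intro s hs
    have hu : IsUnit (s • (1 : Matrix (Fin n) (Fin n) ℂ) - M.A) :=
      isUnit_resolvent fun he => absurd hs (not_le.2 (hA _ he))
    have h1 := fun i j => differentiableAt_inv_apply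
      (M := fun s : ℂ => s • (1 : Matrix (Fin n) (Fin n) ℂ) - M.A) (z := s)
      (fun i j => by simp only [Matrix.sub_apply, Matrix.smul_apply]; fun_prop) hu i j
    exact (differentiableAt_dotProduct_affine h1 (star x) x M.B M.C M.D).neg.cexp
  have hcont : Continuous fun N : Matrix (Fin m) (Fin m) ℂ => Complex.exp (-(star x ⬝ᵥ (N *ᵥ x))) := by
    fun_prop
  have hlim := (hcont.tendsto M.D).comp (tendsto_transfer M)
  have h1 : ‖f s‖ ≤ 1 := by
    -- f = exp(-xᴴZx) has a finite limit at infinity, so the growth condition holds with exponent 1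
    -- and constant 0.
    refine PhragmenLindelof.right_half_plane_of_bounded_on_real ?_ ⟨1, by norm_num, 0, ?_⟩ ?_ ?_ hs
    · refine DifferentiableOn.diffContOnCl fun s hs => ?_
      rw [Complex.closure_setOfPred_lt_re] at hs
      exact (hd s hs).differentiableWithinAt
    · simp only [zero_mul, Real.exp_zero]
      exact (hlim.isBigO_one ℝ).mono inf_le_left
    · have ht : Filter.Tendsto (fun x : ℝ => (x : ℂ)) Filter.atTop (Bornology.cobounded ℂ) := by
        rw [← tendsto_norm_atTop_iff_cobounded]
        simpa using Filter.tendsto_abs_atTop_atTop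
      exact (hlim.comp ht).norm.isBoundedUnder_le
    · intro ω
      rw [hn, Real.exp_le_one_iff, Left.neg_nonpos_iff]
      have h2 := re_nonneg_of_posSemidef (hP ω) x
      rw [popov_axis, re_star_dotProduct_conjTranspose] at h2
      rw [mul_comm (ω : ℂ)]
      linarith
  rw [hn, Real.exp_le_one_iff, Left.neg_nonpos_iff] at h1
  exact h1

/-- The feedthrough matrix inherits non-negativity from the Popov function on the axis. -/
theorem posSemidef_feedthrough (hP : ∀ ω : ℝ, (M.popov (Complex.I * ω)).PosSemidef) :
    (M.Dᴴ + M.D).PosSemidef := by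
  have ht : Filter.Tendsto (fun ω : ℝ => Complex.I * ω) Filter.atTop (Bornology.cobounded ℂ) := by
    rw [← tendsto_norm_atTop_iff_cobounded]
    simpa using Filter.tendsto_abs_atTop_atTop
  refine .of_dotProduct_mulVec_nonneg ?_ fun x => ?_
  · rw [Matrix.IsHermitian, Matrix.conjTranspose_add, Matrix.conjTranspose_conjTranspose, add_comm]
  · have hc : Continuous fun N : Matrix (Fin m) (Fin m) ℂ => star x ⬝ᵥ ((Nᴴ + N) *ᵥ x) := by
      fun_prop
    refine ge_of_tendsto' ((hc.tendsto M.D).comp ((tendsto_transfer M).comp ht)) fun ω => ?_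
    have := (hP ω).dotProduct_mulVec_nonneg x
    rwa [popov_axis] at this

end PassiveLTI

/-! ### Passage between real and complex matrices; monotonicity in the shift. -/

namespace PassiveLTI

section Cpx

variable {ι κ l : Type}

theorem cpx_mul [Fintype κ] (M : Matrix ι κ ℝ) (N : Matrix κ l ℝ) :
    cpx (M * N) = cpx M * cpx N :=
  Matrix.map_mul (f := Complex.ofRealHom)

theorem cpx_add (M N : Matrix ι κ ℝ) : cpx (M + N) = cpx M + cpx N := by
  ext i j; simp [cpx]

theorem cpx_sub (M N : Matrix ι κ ℝ) : cpx (M - N) = cpx M - cpx N := by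
  ext i j; simp [cpx]

theorem cpx_neg (M : Matrix ι κ ℝ) : cpx (-M) = -cpx M := by
  ext i j; simp [cpx]

theorem cpx_zero : cpx (0 : Matrix ι κ ℝ) = 0 := by
  ext i j; simp [cpx]

theorem cpx_smul (c : ℝ) (M : Matrix ι κ ℝ) : cpx (c • M) = (c : ℂ) • cpx M := by
  ext i j; simp [cpx]

theorem cpx_one [DecidableEq ι] : cpx (1 : Matrix ι ι ℝ) = 1 := by
  simp [cpx]

theorem cpx_transpose (M : Matrix ι κ ℝ) : cpx Mᵀ = (cpx M)ᵀ := rfl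

theorem cpx_conjTranspose (M : Matrix ι κ ℝ) : (cpx M)ᴴ = cpx Mᵀ := by
  ext i j; simp [cpx]

theorem cpx_injective : Function.Injective (cpx : Matrix ι κ ℝ → Matrix ι κ ℂ) :=
  fun _ _ h => Matrix.map_injective Complex.ofReal_injective h

theorem cpx_pow [Fintype ι] [DecidableEq ι] (M : Matrix ι ι ℝ) (j : ℕ) :
    cpx (M ^ j) = cpx M ^ j := by
  induction j with
  | zero => simp [cpx_one]
  | succ j ih => rw [pow_succ, cpx_mul, ih, pow_succ]

theorem cpx_fromBlocks {ι' κ' : Type} (A : Matrix ι κ ℝ) (B : Matrix ι κ' ℝ) (C : Matrix ι' κ ℝ)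
    (D : Matrix ι' κ' ℝ) :
    cpx (Matrix.fromBlocks A B C D) = Matrix.fromBlocks (cpx A) (cpx B) (cpx C) (cpx D) :=
  Matrix.fromBlocks_map A B C D _

/-- Entrywise embedding of real vectors into complex ones. -/
def cpxVec (x : ι → ℝ) : ι → ℂ := fun i => (x i : ℂ)

theorem cpx_mulVec [Fintype κ] (M : Matrix ι κ ℝ) (x : κ → ℝ) :
    cpx M *ᵥ cpxVec x = cpxVec (M *ᵥ x) := by
  ext i; simp [Matrix.mulVec, dotProduct, cpx, cpxVec]

theorem cpxVec_dotProduct [Fintype ι] (x y : ι → ℝ) :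
    star (cpxVec x) ⬝ᵥ cpxVec y = ((x ⬝ᵥ y : ℝ) : ℂ) := by
  simp [dotProduct, cpxVec]

theorem cpxVec_eq_zero {x : ι → ℝ} : cpxVec x = 0 ↔ x = 0 := by
  simp [funext_iff, cpxVec]

end Cpx

theorem cpx_shift {k : ℕ} (A : Matrix (Fin k) (Fin k) ℝ) (c : ℝ) :
    cpx (A + c • 1) = cpx A + (c : ℂ) • 1 := by
  rw [cpx_add, cpx_smul, cpx_one]

theorem star_dotProduct_im_eq_zero {ι : Type} [Fintype ι] {N : Matrix ι ι ℂ} (hN : N.IsHermitian)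
    (x : ι → ℂ) : (star x ⬝ᵥ (N *ᵥ x)).im = 0 := by
  refine Complex.conj_eq_iff_im.1 ?_
  rw [← Complex.star_def, ← Matrix.star_dotProduct, Matrix.star_mulVec, hN.eq,
    ← Matrix.dotProduct_mulVec]

theorem posDef_of_re_pos {ι : Type} [Fintype ι] {N : Matrix ι ι ℂ} (hN : N.IsHermitian)
    (h : ∀ x : ι → ℂ, x ≠ 0 → 0 < (star x ⬝ᵥ (N *ᵥ x)).re) : N.PosDef :=
  .of_dotProduct_mulVec_pos hN fun x hx =>
    Complex.lt_def.2 ⟨h x hx, (star_dotProduct_im_eq_zero hN x).symm⟩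

theorem re_star_dotProduct_self_pos {ι : Type} [Fintype ι] {x : ι → ℂ} (hx : x ≠ 0) :
    0 < (star x ⬝ᵥ x).re :=
  (Complex.lt_def.1 (Matrix.dotProduct_star_self_pos_iff.2 hx)).1

variable {n m k : ℕ}

theorem posDef_popov_of_re_pos (M : Model ℂ n m) (ω : ℝ)
    (h : ∀ x : Fin m → ℂ, x ≠ 0 → 0 < (star x ⬝ᵥ (M.transfer (Complex.I * ω) *ᵥ x)).re) :
    (M.popov (Complex.I * ω)).PosDef := by
  rw [popov_axis]
  refine posDef_of_re_pos ?_ fun x hx => ?_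
  · rw [Matrix.IsHermitian, Matrix.conjTranspose_add, Matrix.conjTranspose_conjTranspose, add_comm]
  · rw [re_star_dotProduct_conjTranspose]
    have := h x hx
    linarith

theorem isEigenvalue_shift (M : Model ℝ n m) (ξ : ℝ) (μ : ℂ) :
    IsEigenvalue (M.shift ξ).toComplex.A μ ↔ IsEigenvalue (cpx M.A) (μ - ξ / 2) := by
  have : (M.shift ξ).toComplex.A = cpx M.A + ((ξ / 2 : ℝ) : ℂ) • 1 := cpx_shift M.A (ξ / 2)
  rw [this, isEigenvalue_add_smul_one]
  push_cast
  rfl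

/-- The shifts with a strictly passive shifted model form a lower set. -/
theorem strictlyPassive_shift_of_lt_shiftSup (M : Model ℝ n m) {ξ : ℝ}
    (hξ : (ξ : EReal) < M.shiftSup) : (M.shift ξ).toComplex.StrictlyPassive := by
  simp only [Model.shiftSup, lt_iSup_iff] at hξ
  obtain ⟨η, hη, hlt⟩ := hξ
  obtain ⟨hP, hA⟩ : (M.shift η).toComplex.StrictlyPassive := hη
  have hlt' : ξ < η := EReal.coe_lt_coe_iff.1 hlt
  have hA' : (M.shift ξ).toComplex.AsymptoticallyStable := by
    intro μ hμ
    rw [isEigenvalue_shift] at hμ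
    have := hA (μ - ξ / 2 + η / 2) (by rw [isEigenvalue_shift]; simpa using hμ)
    simp at this
    linarith
  refine ⟨fun ω => ⟨fun he => ?_, ?_⟩, hA'⟩
  · have := hA' _ he
    simp at this
  · refine posDef_popov_of_re_pos _ ω fun x hx => ?_
    -- Both sides evaluate Z at iω - ξ/2; the gap between the feedthrough terms supplies the strict
    -- positivity.
    have hs : (M.shift ξ).toComplex.transfer (Complex.I * ω) =
        (M.shift η).toComplex.transfer (Complex.I * ω + (((η - ξ) / 2 : ℝ) : ℂ)) +
          (((η - ξ) / 2 : ℝ) : ℂ) • 1 := by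
      rw [transfer_shift, transfer_shift]
      have : Complex.I * ω + (((η - ξ) / 2 : ℝ) : ℂ) - (η : ℂ) / 2 = Complex.I * ω - (ξ : ℂ) / 2 := by
        push_cast; ring
      rw [this, sub_add, ← sub_smul]
      congr 2
      push_cast; ring
    rw [hs, Matrix.add_mulVec, dotProduct_add, Matrix.smul_mulVec, Matrix.one_mulVec,
      dotProduct_smul, Complex.add_re, smul_eq_mul, Complex.re_ofReal_mul]
    have h1 := re_transfer_nonneg hA (fun ω => (hP ω).2.posSemidef)
      (s := Complex.I * ω + (((η - ξ) / 2 : ℝ) : ℂ)) (by simp; linarith) x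
    have h2 := mul_pos (a := (η - ξ) / 2) (by linarith) (re_star_dotProduct_self_pos hx)
    linarith

section RealPencil

variable {M : Model ℝ n m} {U V : Matrix (Fin n) (Fin k) ℝ} {W : Matrix (Fin m) (Fin k) ℝ}
  {R : Matrix (Fin k) (Fin k) ℝ}

theorem Model.IsDeflatingBasis.equations (h : M.IsDeflatingBasis U V W R) :
    M.A * V + M.B * W = V * R ∧ M.Aᵀ * U + M.Cᵀ * W = -(U * R) ∧
      M.Bᵀ * U + M.C * V + (M.Dᵀ + M.D) * W = 0 := by
  -- The terms in s agree on both sides of the pencil equation, so s = 0 carries all its content.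
  have h0 := h.2 0
  rw [Model.pencil, Matrix.fromBlocks_mul_fromRows, Matrix.fromBlocks_mul_fromRows,
    Matrix.fromRows_mul, Matrix.fromRows_mul, Matrix.fromRows_mul] at h0
  simp only [zero_smul, sub_zero, add_zero, Matrix.zero_mul, zero_add, Matrix.neg_mul,
    Matrix.fromCols_mul_fromRows] at h0
  have h1 := congrArg (fun N => N.toRows₁.toRows₁) h0
  have h2 := congrArg (fun N => N.toRows₁.toRows₂) h0
  have h3 := congrArg (fun N => N.toRows₂) h0
  exact ⟨h1, h2, h3⟩

theorem Model.IsDeflatingBasis.deflates (h : M.IsDeflatingBasis U V W R) :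
    M.toComplex.Deflates (cpx U) (cpx V) (cpx W) (cpx R) := by
  obtain ⟨h1, h2, h3⟩ := h.equations
  refine ⟨?_, ?_, ?_⟩
  · simpa only [cpx_add, cpx_mul] using! congrArg cpx h1
  · simpa only [cpx_add, cpx_mul, cpx_neg, ← cpx_conjTranspose] using! congrArg cpx h2
  · simpa only [cpx_add, cpx_mul, cpx_zero, ← cpx_conjTranspose] using! congrArg cpx h3

end RealPencil

theorem mulVec_injective_of_rank_eq {ι : Type} [Fintype ι] {N : Matrix ι (Fin n) ℝ}
    (h : N.rank = n) : Function.Injective N.mulVec := by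
  have h1 := LinearMap.finrank_range_add_finrank_ker N.mulVecLin
  rw [← Matrix.rank, h, Module.finrank_fin_fun] at h1
  have h2 : LinearMap.ker N.mulVecLin = ⊥ := Submodule.finrank_eq_zero.1 (by omega)
  exact LinearMap.ker_eq_bot.1 h2

theorem rank_eq_of_mulVec_injective {N : Matrix (Fin n) (Fin k) ℝ}
    (h : ∀ x, N *ᵥ x = 0 → x = 0) : N.rank = k := by
  have h1 : Function.Injective N.mulVecLin :=
    LinearMap.ker_eq_bot.1 (LinearMap.ker_eq_bot'.2 h)
  rw [Matrix.rank, LinearMap.finrank_range_of_inj h1, Module.finrank_fin_fun]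

theorem Model.Controllable.eq_zero {M : Model ℝ n m} (h : M.Controllable) {x : Fin n → ℝ}
    (hx : ∀ j : ℕ, M.Bᵀ *ᵥ ((M.Aᵀ ^ j) *ᵥ x) = 0) : x = 0 := by
  rw [Model.Controllable, ← Matrix.rank_transpose] at h
  refine mulVec_injective_of_rank_eq h ?_
  rw [Matrix.mulVec_zero]
  ext p
  have h1 := congrFun (hx p.1) p.2
  rw [Matrix.mulVec_mulVec, ← Matrix.transpose_pow, ← Matrix.transpose_mul] at h1
  exact h1

end PassiveLTI

/-! ### Positive definite storage and the factored matrix inequality. -/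

namespace PassiveLTI

variable {n m k : ℕ} {M : Model ℝ n m} {U V : Matrix (Fin n) (Fin k) ℝ}
  {W : Matrix (Fin m) (Fin k) ℝ} {R : Matrix (Fin k) (Fin k) ℝ} {ξ : ℝ}

theorem Model.IsDeflatingBasis.isSymm (h : M.IsDeflatingBasis U V W R)
    (hR : ∀ μ : ℂ, IsEigenvalue (cpx R) μ → 0 < μ.re) : (Uᵀ * V).IsSymm := by
  have h1 := h.deflates.isHermitian hR
  rw [cpx_conjTranspose, ← cpx_mul, Matrix.IsHermitian, cpx_conjTranspose] at h1
  exact cpx_injective h1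

/-- On the subspace of initial values whose trajectory has zero state and input, the costate is
unobservable from the dual output. -/
theorem Model.IsDeflatingBasis.dual_output_eq_zero (h : (M.shift ξ).IsDeflatingBasis U V W R)
    (j : ℕ) (y : Fin k → ℝ) (hV : ∀ i : ℕ, V *ᵥ ((R ^ i) *ᵥ y) = 0)
    (hW : ∀ i : ℕ, W *ᵥ ((R ^ i) *ᵥ y) = 0) : M.Bᵀ *ᵥ ((M.Aᵀ ^ j) *ᵥ (U *ᵥ y)) = 0 := by
  obtain ⟨-, h2, h3⟩ := h.equations
  have hV0 : V *ᵥ y = 0 := by simpa using hV 0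
  have hW0 : W *ᵥ y = 0 := by simpa using hW 0
  induction j generalizing y with
  | zero =>
    have := congrArg (· *ᵥ y) h3
    simpa [Matrix.add_mulVec, ← Matrix.mulVec_mulVec, hV0, hW0, Model.shift] using this
  | succ j ih =>
    -- With zero input, Aᵀ acts on Uy by replacing y with -Ry - (ξ/2)y, which satisfies the same
    -- hypotheses; hence the induction generalizes y.
    have h4 : M.Aᵀ *ᵥ (U *ᵥ y) = U *ᵥ (-(R *ᵥ y) - (ξ / 2) • y) := by
      have := congrArg (· *ᵥ y) h2
      simp only [Model.shift, Matrix.transpose_add, Matrix.transpose_smul, Matrix.transpose_one,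
        Matrix.add_mulVec, Matrix.add_mul, ← Matrix.mulVec_mulVec, hW0, Matrix.mulVec_zero,
        Matrix.smul_mul, Matrix.one_mul, Matrix.smul_mulVec, Matrix.neg_mulVec] at this
      rw [Matrix.mulVec_sub, Matrix.mulVec_neg, Matrix.mulVec_smul, ← this]
      abel
    have hgen : ∀ {a : ℕ} {N : Matrix (Fin a) (Fin k) ℝ}, (∀ i : ℕ, N *ᵥ ((R ^ i) *ᵥ y) = 0) →
        ∀ i : ℕ, N *ᵥ ((R ^ i) *ᵥ (-(R *ᵥ y) - (ξ / 2) • y)) = 0 := by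
      intro a N hN i
      have := hN (i + 1)
      rw [pow_succ, ← Matrix.mulVec_mulVec] at this
      rw [Matrix.mulVec_sub, Matrix.mulVec_sub, Matrix.mulVec_neg, Matrix.mulVec_neg,
        Matrix.mulVec_smul, Matrix.mulVec_smul, this, hN i]
      simp
    rw [pow_succ, ← Matrix.mulVec_mulVec, h4]
    exact ih _ (hgen hV) (hgen hW) (by simpa using hgen hV 0) (by simpa using hgen hW 0)

theorem Model.IsDeflatingBasis.eq_zero (h : M.IsDeflatingBasis U V W R) {x : Fin k → ℝ}
    (hU : U *ᵥ x = 0) (hV : V *ᵥ x = 0) (hW : W *ᵥ x = 0) : x = 0 := by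
  refine Matrix.mulVec_injective_iff.2 h.1 ?_
  rw [Matrix.mulVec_zero, Matrix.fromRows_mulVec, Matrix.fromRows_mulVec, hU, hV, hW]
  ext i
  rcases i with (i | i) | i <;> rfl

theorem posSemidef_transpose_add_feedthrough (h : M.toComplex.StrictlyPassive) :
    (M.Dᵀ + M.D).PosSemidef := by
  have h1 := posSemidef_feedthrough (fun ω => (h.1 ω).2.posSemidef)
  have h2 : (M.toComplex.D)ᴴ + M.toComplex.D = cpx (M.Dᵀ + M.D) := by
    rw [cpx_add, ← cpx_conjTranspose]; rfl
  rw [h2] at h1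
  refine .of_dotProduct_mulVec_nonneg ?_ fun x => ?_
  · rw [Matrix.IsHermitian, Matrix.conjTranspose_eq_transpose_of_trivial, Matrix.transpose_add,
      Matrix.transpose_transpose, add_comm]
  · have := re_nonneg_of_posSemidef h1 (cpxVec x)
    rwa [cpx_mulVec, cpxVec_dotProduct, Complex.ofReal_re] at this

theorem Model.IsDeflatingBasis.posDef (h : (M.shift ξ).IsDeflatingBasis U V W R)
    (hc : M.Controllable) (hP : (M.shift ξ).toComplex.StrictlyPassive)
    (hR : ∀ μ : ℂ, IsEigenvalue (cpx R) μ → 0 < μ.re) : (-(Uᵀ * V)).PosDef := by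
  have hsymm := h.isSymm hR
  have hD := posSemidef_feedthrough (fun ω => (hP.1 ω).2.posSemidef)
  have key := fun x : Fin k → ℝ => h.deflates.storage_nonneg hP.2 hR (fun ω => (hP.1 ω).2) hD
    (cpxVec x)
  rw [cpx_conjTranspose, ← cpx_mul, ← cpx_neg] at key
  simp only [cpx_mulVec, cpxVec_dotProduct, Complex.ofReal_re, ← cpx_pow, cpxVec_eq_zero] at key
  refine .of_dotProduct_mulVec_pos ?_ fun x hx => ?_
  · rw [Matrix.IsHermitian, Matrix.conjTranspose_eq_transpose_of_trivial, Matrix.transpose_neg,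
      hsymm.eq]
  rw [star_trivial]
  refine lt_of_le_of_ne (key x).1 fun h0 => hx ?_
  have hW := (key x).2 h0.symm
  have hst : ∀ y, (M.shift ξ).A *ᵥ (V *ᵥ y) + (M.shift ξ).B *ᵥ (W *ᵥ y) = V *ᵥ (R *ᵥ y) := fun y => by
    simp only [Matrix.mulVec_mulVec, ← Matrix.add_mulVec, h.equations.1]
  have hint : ∀ j : ℕ, ((M.shift ξ).A ^ j) *ᵥ (V *ᵥ x) = V *ᵥ ((R ^ j) *ᵥ x) := by
    intro j
    induction j with
    | zero => simp
    | succ j ih =>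
      rw [pow_succ', ← Matrix.mulVec_mulVec, ih, pow_succ', ← Matrix.mulVec_mulVec, ← hst, hW j,
        Matrix.mulVec_zero, add_zero]
  -- With zero input the state follows both the stable shifted A and the antistable R.
  have hVx : V *ᵥ x = 0 := by
    have h1 := mulVec_eq_zero_of_intertwine (A := cpx (M.shift ξ).A) (R := cpx R) (V := cpx V)
      (r := cpxVec x) (fun j => by simp only [← cpx_pow, cpx_mulVec, hint])
      (fun μ hμ hμ' => lt_asymm (hP.2 μ hμ) (hR μ hμ'))
    rwa [cpx_mulVec, cpxVec_eq_zero] at h1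
  have hV : ∀ j : ℕ, V *ᵥ ((R ^ j) *ᵥ x) = 0 := fun j => by
    rw [← hint, hVx, Matrix.mulVec_zero]
  have hUx : U *ᵥ x = 0 := hc.eq_zero fun j => h.dual_output_eq_zero j x hV hW
  exact h.eq_zero hUx hVx (by simpa using hW 0)

theorem rank_left_of_posDef (hX : (-(Uᵀ * V)).PosDef) : U.rank = k :=
  rank_eq_of_mulVec_injective fun x hx => by
    by_contra h0
    have := hX.dotProduct_mulVec_pos h0
    rw [Matrix.neg_mulVec, ← Matrix.mulVec_mulVec, star_trivial, dotProduct_neg,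
      Matrix.dotProduct_mulVec, Matrix.vecMul_transpose, hx, zero_dotProduct, neg_zero] at this
    exact lt_irrefl _ this

theorem rank_right_of_posDef (hX : (-(Uᵀ * V)).PosDef) : V.rank = k :=
  rank_eq_of_mulVec_injective fun x hx => by
    by_contra h0
    have := hX.dotProduct_mulVec_pos h0
    rw [Matrix.neg_mulVec, ← Matrix.mulVec_mulVec, hx, Matrix.mulVec_zero, neg_zero,
      dotProduct_zero] at this
    exact lt_irrefl _ this

theorem isUnit_det_of_posDef_neg {Y : Matrix (Fin k) (Fin k) ℝ} (hX : (-Y).PosDef) :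
    IsUnit Y.det := by
  rw [← Matrix.isUnit_iff_isUnit_det]
  exact (IsUnit.neg_iff Y).1 hX.isUnit

theorem mul_project_A (hY : IsUnit (Uᵀ * V).det) :
    (Uᵀ * V) * (M.project U V).A = Uᵀ * M.A * V := by
  simp only [Model.project, Matrix.mul_assoc]
  rw [← Matrix.mul_assoc Uᵀ V, Matrix.mul_nonsing_inv_cancel_left _ _ hY]

theorem mul_project_B (hY : IsUnit (Uᵀ * V).det) :
    (Uᵀ * V) * (M.project U V).B = Uᵀ * M.B := by
  simp only [Model.project, Matrix.mul_assoc]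
  rw [← Matrix.mul_assoc Uᵀ V, Matrix.mul_nonsing_inv_cancel_left _ _ hY]

/-- The passivity inequality of the projected model factors through the feedthrough matrix. -/
theorem Model.IsDeflatingBasis.lmi_project (h : (M.shift ξ).IsDeflatingBasis U V W R)
    (hsymm : (Uᵀ * V).IsSymm) (hY : IsUnit (Uᵀ * V).det) :
    (M.project U V).lmi (-(Uᵀ * V)) -
      ξ • Matrix.fromBlocks (-(Uᵀ * V)) 0 0 (1 : Matrix (Fin m) (Fin m) ℝ) =
    (Matrix.fromCols (-W) (1 : Matrix (Fin m) (Fin m) ℝ))ᴴ *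
      ((M.shift ξ).Dᵀ + (M.shift ξ).D) * Matrix.fromCols (-W) 1 := by
  obtain ⟨h1, h2, h3⟩ := h.equations
  set Φ := (M.shift ξ).Dᵀ + (M.shift ξ).D with hΦ
  have hΦT : Φᵀ = Φ := by rw [hΦ, Matrix.transpose_add, Matrix.transpose_transpose, add_comm]
  have hΦD : M.Dᵀ + M.D = Φ + ξ • 1 := by
    simp only [hΦ, Model.shift, Matrix.transpose_sub, Matrix.transpose_smul, Matrix.transpose_one]
    module
  have h3' : M.C * V + M.Bᵀ * U = -(Φ * W) := by
    rw [eq_neg_iff_add_eq_zero, ← h3, add_comm (M.C * V)]; rfl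
  have h3T : Vᵀ * M.Cᵀ + Uᵀ * M.B = -(Wᵀ * Φ) := by
    have := congrArg Matrix.transpose h3'
    simpa [Matrix.transpose_add, Matrix.transpose_mul, hΦT] using this
  have hA := mul_project_A (M := M) hY
  have hB := mul_project_B (M := M) hY
  have hAT : (M.project U V).Aᵀ * (Uᵀ * V) = Vᵀ * M.Aᵀ * U := by
    have := congrArg Matrix.transpose hA
    rw [Matrix.transpose_mul, hsymm.eq] at this
    simpa [Matrix.transpose_mul, Matrix.mul_assoc] using this
  have hBT : (M.project U V).Bᵀ * (Uᵀ * V) = M.Bᵀ * U := by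
    have := congrArg Matrix.transpose hB
    rw [Matrix.transpose_mul, hsymm.eq] at this
    simpa [Matrix.transpose_mul] using this
  have hAA : Uᵀ * M.A * V + Vᵀ * M.Aᵀ * U + ξ • (Uᵀ * V) = Wᵀ * Φ * W := by
    have hVU : Vᵀ * U = Uᵀ * V := by
      simpa [Matrix.transpose_mul] using hsymm.eq
    have e1 : Uᵀ * M.A * V + (ξ / 2) • (Uᵀ * V) + Uᵀ * M.B * W = Uᵀ * V * R := by
      have := congrArg (Uᵀ * ·) h1
      simpa [Model.shift, Matrix.mul_add, Matrix.add_mul, Matrix.mul_assoc] using this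
    have e2 : Vᵀ * M.Aᵀ * U + (ξ / 2) • (Uᵀ * V) + Vᵀ * M.Cᵀ * W = -(Uᵀ * V * R) := by
      have := congrArg (Vᵀ * ·) h2
      rw [← hVU]
      simpa [Model.shift, Matrix.mul_add, Matrix.add_mul, Matrix.mul_assoc] using this
    have e3 := congrArg (· * W) h3T
    simp only [Matrix.add_mul, Matrix.neg_mul] at e3
    -- Adding the state and costate equations cancels UᵀVR, and the output equation turns the mixed
    -- terms into WᵀΦW; the two halves ξ/2 add up to ξ.
    linear_combination (norm := module) e1 + e2 - e3
  rw [lmi_real, Matrix.conjTranspose_eq_transpose_of_trivial, Matrix.transpose_fromCols,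
    Matrix.fromRows_mul, Matrix.fromRows_mul_fromCols, Matrix.fromBlocks_smul,
    sub_eq_add_neg, Matrix.fromBlocks_neg, Matrix.fromBlocks_add]
  simp only [Matrix.neg_mul, Matrix.mul_neg, neg_neg, sub_neg_eq_add, hA, hB, hAT, hBT,
    Matrix.transpose_neg, Matrix.transpose_one, Matrix.one_mul, Matrix.mul_one, smul_zero, neg_zero,
    add_zero]
  congr 1
  · rw [← hAA]; module
  · rw [← h3T]; simp [Model.project, Matrix.transpose_mul]
  · have : (M.project U V).D = M.D := rfl
    rw [this, hΦD]; abel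

end PassiveLTI

/-! ### Tangential interpolation and the spectrum of the projected model. -/

namespace PassiveLTI

variable {n m k : ℕ}

theorem transfer_mulVec {M : Model ℂ n m} {s : ℂ} (hs : ¬ IsEigenvalue M.A s) {v : Fin n → ℂ}
    {w : Fin m → ℂ} (h : M.A *ᵥ v + M.B *ᵥ w = s • v) :
    M.transfer s *ᵥ w = M.C *ᵥ v + M.D *ᵥ w := by
  have hu := (Matrix.isUnit_iff_isUnit_det _).1 (isUnit_resolvent hs)
  have h1 : (s • (1 : Matrix (Fin n) (Fin n) ℂ) - M.A) *ᵥ v = M.B *ᵥ w := by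
    rw [Matrix.sub_mulVec, Matrix.smul_mulVec, Matrix.one_mulVec, ← h]
    abel
  rw [Model.transfer, Matrix.add_mulVec, ← Matrix.mulVec_mulVec, ← Matrix.mulVec_mulVec, ← h1,
    Matrix.mulVec_mulVec _ _ (s • 1 - M.A), Matrix.nonsing_inv_mul _ hu, Matrix.one_mulVec]

/-- The transposed function is the transfer function of the dual model, to which the right-hand
version applies. -/
theorem vecMul_transfer {M : Model ℂ n m} {s : ℂ} (hs : ¬ IsEigenvalue M.A s) {q : Fin n → ℂ}
    {w : Fin m → ℂ} (h : M.Aᵀ *ᵥ q + M.Cᵀ *ᵥ w = s • q) :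
    w ᵥ* M.transfer s = M.Bᵀ *ᵥ q + M.Dᵀ *ᵥ w := by
  have h1 : M.transfer s = ((⟨M.Aᵀ, M.Cᵀ, M.Bᵀ, M.Dᵀ⟩ : Model ℂ n m).transfer s)ᵀ := by
    simp [Model.transfer, Matrix.transpose_nonsing_inv, Matrix.mul_assoc]
  rw [h1, Matrix.vecMul_transpose]
  exact transfer_mulVec (M := ⟨M.Aᵀ, M.Cᵀ, M.Bᵀ, M.Dᵀ⟩)
    (fun he => hs (isEigenvalue_transpose he)) h

open scoped MatrixOrder Matrix.Norms.L2Operator in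
-- A real positive semi-definite matrix is a Gram matrix BᵀB, and it remains one after
-- complexification.
theorem posSemidef_cpx {ι : Type} [Fintype ι] {N : Matrix ι ι ℝ} (h : N.PosSemidef) :
    (cpx N).PosSemidef := by
  classical
  obtain ⟨B, rfl⟩ := CStarAlgebra.nonneg_iff_eq_star_mul_self.1 h.nonneg
  rw [Matrix.star_eq_conjTranspose, cpx_mul, Matrix.conjTranspose_eq_transpose_of_trivial, ← cpx_conjTranspose]
  exact Matrix.posSemidef_conjTranspose_mul_self _

theorem posDef_cpx {ι : Type} [Fintype ι] {N : Matrix ι ι ℝ} (h : N.PosDef) :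
    (cpx N).PosDef := by
  classical
  refine (posSemidef_cpx h.posSemidef).posDef_iff_isUnit.2 ?_
  exact h.isUnit.map (Complex.ofRealHom.mapMatrix : Matrix ι ι ℝ →+* Matrix ι ι ℂ)

theorem re_lyapunov_eigenvector {A X : Matrix (Fin n) (Fin n) ℂ} {μ : ℂ} {v : Fin n → ℂ}
    (hv : A *ᵥ v = μ • v) :
    (star v ⬝ᵥ ((-(Aᴴ * X) - X * A) *ᵥ v)).re = -(2 * μ.re * (star v ⬝ᵥ (X *ᵥ v)).re) := by
  rw [Matrix.sub_mulVec, Matrix.neg_mulVec, ← Matrix.mulVec_mulVec, ← Matrix.mulVec_mulVec, hv,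
    dotProduct_sub, dotProduct_neg, ← star_mulVec_dotProduct, hv, Matrix.mulVec_smul,
    dotProduct_smul, star_smul, smul_dotProduct]
  simp only [smul_eq_mul, Complex.sub_re, Complex.neg_re, Complex.mul_re, Complex.star_def,
    Complex.conj_re, Complex.conj_im]
  ring

variable {M : Model ℝ n m} {U V : Matrix (Fin n) (Fin k) ℝ}
  {W : Matrix (Fin m) (Fin k) ℝ} {R : Matrix (Fin k) (Fin k) ℝ} {ξ : ℝ}

theorem Model.IsDeflatingBasis.lmi_project_posSemidef (h : (M.shift ξ).IsDeflatingBasis U V W R)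
    (hsymm : (Uᵀ * V).IsSymm) (hX : (-(Uᵀ * V)).PosDef)
    (hP : (M.shift ξ).toComplex.StrictlyPassive) :
    ((M.project U V).lmi (-(Uᵀ * V)) -
      ξ • Matrix.fromBlocks (-(Uᵀ * V)) 0 0 (1 : Matrix (Fin m) (Fin m) ℝ)).PosSemidef := by
  rw [h.lmi_project hsymm (isUnit_det_of_posDef_neg hX)]
  exact (posSemidef_transpose_add_feedthrough hP).conjTranspose_mul_mul_same _

/-- The leading block is the Lyapunov inequality -AᵀX - XA ⪰ ξX; testing it on an eigenvector v
gives -2 Re μ · vᴴXv ≥ ξ vᴴXv. -/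
theorem re_eigenvalue_le_of_lmi {N : Model ℝ k m} {X : Matrix (Fin k) (Fin k) ℝ} (hX : X.PosDef)
    (h : (N.lmi X - ξ • Matrix.fromBlocks X 0 0 (1 : Matrix (Fin m) (Fin m) ℝ)).PosSemidef)
    {μ : ℂ} (hμ : IsEigenvalue (cpx N.A) μ) : μ.re ≤ -(ξ / 2) := by
  have h1 : (-(N.Aᴴ * X) - X * N.A - ξ • X).PosSemidef := by
    have := h.submatrix Sum.inl
    simpa [Model.lmi, Matrix.fromBlocks_smul, sub_eq_add_neg, Matrix.fromBlocks_neg,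
      Matrix.fromBlocks_add, Matrix.submatrix, ← Matrix.ext_iff] using! this
  obtain ⟨v, hv0, hv⟩ := isEigenvalue_iff.1 hμ
  have h2 := re_nonneg_of_posSemidef (posSemidef_cpx h1) v
  have h3 := (Complex.lt_def.1 ((posDef_cpx hX).dotProduct_mulVec_pos hv0)).1
  rw [Complex.zero_re] at h3
  rw [cpx_sub, cpx_sub, cpx_neg, cpx_mul, cpx_mul, cpx_smul,
    Matrix.conjTranspose_eq_transpose_of_trivial, ← cpx_conjTranspose, Matrix.sub_mulVec,
    dotProduct_sub, Complex.sub_re, re_lyapunov_eigenvector hv, Matrix.smul_mulVec,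
    dotProduct_smul, smul_eq_mul, Complex.re_ofReal_mul] at h2
  nlinarith

/-- The oblique projection (UᵀV)⁻¹Uᵀ applied to the state equation: the projected model follows the
same flow R with V replaced by the identity. In `project_costate`, UᵀV plays the role of U. -/
theorem project_state (h : (M.shift ξ).IsDeflatingBasis U V W R) (hY : IsUnit (Uᵀ * V).det) :
    (M.project U V).A + (M.project U V).B * W = R - (ξ / 2) • 1 := by
  have h1 := congrArg (fun N => (Uᵀ * V)⁻¹ * (Uᵀ * N)) h.equations.1
  simp only [Model.shift, Matrix.mul_add, Matrix.add_mul, Matrix.smul_mul, Matrix.one_mul,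
    Matrix.mul_smul] at h1
  rw [Matrix.nonsing_inv_mul _ hY, ← Matrix.mul_assoc Uᵀ V R,
    Matrix.nonsing_inv_mul_cancel_left _ _ hY] at h1
  rw [← h1]
  simp only [Model.project, Matrix.mul_assoc]
  abel

theorem project_costate (h : (M.shift ξ).IsDeflatingBasis U V W R) (hsymm : (Uᵀ * V).IsSymm)
    (hY : IsUnit (Uᵀ * V).det) :
    (M.project U V).Aᵀ * (Uᵀ * V) + (M.project U V).Cᵀ * W =
      -(Uᵀ * V * R) - (ξ / 2) • (Uᵀ * V) := by
  have hVU : Vᵀ * U = Uᵀ * V := by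
    simpa [Matrix.transpose_mul] using hsymm.eq
  have hAT : (M.project U V).Aᵀ * (Uᵀ * V) = Vᵀ * M.Aᵀ * U := by
    have := congrArg Matrix.transpose (mul_project_A (M := M) hY)
    rw [Matrix.transpose_mul, hsymm.eq] at this
    simpa [Matrix.transpose_mul, Matrix.mul_assoc] using this
  have e2 : Vᵀ * M.Aᵀ * U + (ξ / 2) • (Uᵀ * V) + Vᵀ * M.Cᵀ * W = -(Uᵀ * V * R) := by
    have := congrArg (Vᵀ * ·) h.equations.2.1
    rw [← hVU]
    simpa [Model.shift, Matrix.mul_add, Matrix.add_mul, Matrix.mul_assoc] using this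
  rw [hAT, ← e2]
  simp only [Model.project, Matrix.transpose_mul]
  abel

theorem project_dual_input (hsymm : (Uᵀ * V).IsSymm) (hY : IsUnit (Uᵀ * V).det) :
    (M.project U V).Bᵀ * (Uᵀ * V) = M.Bᵀ * U := by
  have := congrArg Matrix.transpose (mul_project_B (M := M) hY)
  rw [Matrix.transpose_mul, hsymm.eq] at this
  simpa [Matrix.transpose_mul] using this

theorem Model.IsDeflatingBasis.interpolation_right (h : (M.shift ξ).IsDeflatingBasis U V W R)
    (hY : IsUnit (Uᵀ * V).det) {σ : ℂ} {r : Fin k → ℂ} (hr : cpx R *ᵥ r = σ • r)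
    (hA : ¬ IsEigenvalue (cpx M.A) (σ - ξ / 2))
    (hA' : ¬ IsEigenvalue (cpx (M.project U V).A) (σ - ξ / 2)) :
    M.toComplex.transfer (σ - ξ / 2) *ᵥ (cpx W *ᵥ r) =
      (M.project U V).toComplex.transfer (σ - ξ / 2) *ᵥ (cpx W *ᵥ r) := by
  have h1 := congrArg (fun N => cpx N *ᵥ r) h.equations.1
  simp only [Model.shift, cpx_add, cpx_mul, cpx_smul, cpx_one, Matrix.add_mulVec,
    ← Matrix.mulVec_mulVec, Matrix.smul_mulVec, Matrix.one_mulVec, hr, Matrix.mulVec_smul] at h1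
  have h2 := congrArg (fun N => cpx N *ᵥ r) (project_state h hY)
  simp only [cpx_add, cpx_sub, cpx_mul, cpx_smul, cpx_one, Matrix.add_mulVec, Matrix.sub_mulVec,
    ← Matrix.mulVec_mulVec, Matrix.smul_mulVec, Matrix.one_mulVec, hr] at h2
  push_cast at h1 h2
  rw [transfer_mulVec (M := M.toComplex) (v := cpx V *ᵥ r) hA, transfer_mulVec (v := r)
    (M := (M.project U V).toComplex) hA']
  · simp [Model.toComplex, Model.project, cpx_mul]
  · simp only [Model.toComplex]
    rw [h2]; module
  · simp only [Model.toComplex]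
    linear_combination (norm := module) h1

theorem Model.IsDeflatingBasis.interpolation_left (h : (M.shift ξ).IsDeflatingBasis U V W R)
    (hsymm : (Uᵀ * V).IsSymm) (hY : IsUnit (Uᵀ * V).det) {σ : ℂ} {r : Fin k → ℂ}
    (hr : cpx R *ᵥ r = σ • r) (hA : ¬ IsEigenvalue (cpx M.A) (-σ - ξ / 2))
    (hA' : ¬ IsEigenvalue (cpx (M.project U V).A) (-σ - ξ / 2)) :
    (cpx W *ᵥ r) ᵥ* M.toComplex.transfer (-σ - ξ / 2) =
      (cpx W *ᵥ r) ᵥ* (M.project U V).toComplex.transfer (-σ - ξ / 2) := by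
  have h1 := congrArg (fun N => cpx N *ᵥ r) h.equations.2.1
  simp only [Model.shift, Matrix.transpose_add, Matrix.transpose_smul, Matrix.transpose_one,
    cpx_add, cpx_mul, cpx_smul, cpx_one, cpx_neg, Matrix.add_mulVec, Matrix.neg_mulVec,
    ← Matrix.mulVec_mulVec, Matrix.smul_mulVec, Matrix.one_mulVec, hr, Matrix.mulVec_smul] at h1
  have h2 := congrArg (fun N => cpx N *ᵥ r) (project_costate h hsymm hY)
  rw [cpx_add, cpx_sub, cpx_mul _ (Uᵀ * V), cpx_mul _ W, cpx_neg, cpx_smul, cpx_mul _ R, Matrix.add_mulVec,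
    Matrix.sub_mulVec, Matrix.neg_mulVec, Matrix.smul_mulVec, ← Matrix.mulVec_mulVec _ _ (cpx W),
    ← Matrix.mulVec_mulVec _ _ (cpx R), hr, Matrix.mulVec_smul,
    ← Matrix.mulVec_mulVec _ _ (cpx (Uᵀ * V))] at h2
  push_cast at h1 h2
  have h3 := congrArg (fun N => cpx N *ᵥ r) (project_dual_input (M := M) hsymm hY)
  simp only [cpx_mul _ U, cpx_mul _ (Uᵀ * V), ← Matrix.mulVec_mulVec] at h3
  rw [vecMul_transfer (M := M.toComplex) (q := cpx U *ᵥ r) hA,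
    vecMul_transfer (M := (M.project U V).toComplex) (q := cpx (Uᵀ * V) *ᵥ r) hA']
  · simp only [Model.toComplex, ← cpx_transpose]
    rw [h3]; rfl
  · simp only [Model.toComplex, ← cpx_transpose]
    rw [h2]; module
  · simp only [Model.toComplex, ← cpx_transpose]
    linear_combination (norm := module) h1

end PassiveLTI

namespace PassiveLTI

variable {n m : ℕ}

/-! ### Normalized realizations -/

/-- Congruence by diag(T⁻¹, I) carries the storage matrix TᵀT to I. -/
theorem lmi_transform (N : Model ℝ n m) {T : Matrix (Fin n) (Fin n) ℝ} (hT : IsUnit T.det)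
    (ξ : ℝ) :
    (N.transform T).lmi 1 - ξ • (1 : Matrix (Fin n ⊕ Fin m) (Fin n ⊕ Fin m) ℝ) =
      (Matrix.fromBlocks T⁻¹ 0 0 (1 : Matrix (Fin m) (Fin m) ℝ))ᴴ *
        (N.lmi (Tᵀ * T) - ξ • Matrix.fromBlocks (Tᵀ * T) 0 0 (1 : Matrix (Fin m) (Fin m) ℝ)) *
        Matrix.fromBlocks T⁻¹ 0 0 1 := by
  have h1 : T * T⁻¹ = 1 := Matrix.mul_nonsing_inv _ hT
  have h2 : (T⁻¹)ᵀ * Tᵀ = 1 := by rw [← Matrix.transpose_mul, h1, Matrix.transpose_one]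
  have h3 : ∀ {l : ℕ} (X : Matrix (Fin n) (Fin l) ℝ), (T⁻¹)ᵀ * (Tᵀ * X) = X := fun X => by
    rw [← Matrix.mul_assoc, h2, Matrix.one_mul]
  rw [lmi_real, lmi_real, Matrix.conjTranspose_eq_transpose_of_trivial, ← Matrix.fromBlocks_one]
  simp only [Matrix.fromBlocks_transpose, sub_eq_add_neg, Matrix.fromBlocks_smul,
    Matrix.fromBlocks_neg, Matrix.fromBlocks_add, Matrix.fromBlocks_multiply, Model.transform,
    Matrix.transpose_mul, Matrix.transpose_zero, Matrix.transpose_one, Matrix.mul_one,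
    Matrix.one_mul, Matrix.zero_mul, Matrix.mul_zero, add_zero, zero_add, smul_zero, neg_zero,
    Matrix.mul_add, Matrix.add_mul, Matrix.mul_neg, Matrix.neg_mul, Matrix.mul_smul,
    Matrix.smul_mul, Matrix.mul_assoc, h1, h3]

theorem posDef_fromBlocks_one {X : Matrix (Fin n) (Fin n) ℝ} (hX : X.PosDef) :
    (Matrix.fromBlocks X 0 0 (1 : Matrix (Fin m) (Fin m) ℝ)).PosDef := by
  have : Invertible X := hX.isUnit.invertible
  have h1 : (Matrix.fromBlocks X 0 (0 : Matrix (Fin n) (Fin m) ℝ)ᴴ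
      (1 : Matrix (Fin m) (Fin m) ℝ)).PosSemidef := by
    rw [Matrix.PosDef.fromBlocks₁₁ _ _ hX]
    simpa using Matrix.PosSemidef.one
  rw [Matrix.conjTranspose_zero] at h1
  refine h1.posDef_iff_isUnit.2 ?_
  rw [Matrix.isUnit_iff_isUnit_det, Matrix.det_fromBlocks_zero₂₁, Matrix.det_one, mul_one,
    ← Matrix.isUnit_iff_isUnit_det]
  exact hX.isUnit

theorem isNormalizedPortHamiltonian_of_lmi {N : Model ℝ n m} (h : (N.lmi 1).PosSemidef) :
    N.IsNormalizedPortHamiltonian := by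
  -- The symmetric and skew parts of [-A, -B; C, D]; the symmetric one is half of 𝒲(I, N).
  refine ⟨(1 / 2 : ℝ) • (N.A - N.Aᵀ), -((1 / 2 : ℝ) • (N.A + N.Aᵀ)), (1 / 2 : ℝ) • (N.B + N.Cᵀ),
    (1 / 2 : ℝ) • (N.Cᵀ - N.B), (1 / 2 : ℝ) • (N.D - N.Dᵀ), (1 / 2 : ℝ) • (N.D + N.Dᵀ),
    ?_, ?_, Matrix.PosSemidef.one, ?_⟩
  · simp only [Matrix.fromBlocks_transpose, Matrix.fromBlocks_neg, Matrix.transpose_neg,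
      Matrix.transpose_smul, Matrix.transpose_sub, Matrix.transpose_transpose]
    congr 1 <;> module
  · have h1 := h.smul (a := (1 / 2 : ℝ)) (by norm_num)
    rw [lmi_real, Matrix.fromBlocks_smul] at h1
    convert h1 using 2
    · rw [Matrix.mul_one, Matrix.one_mul]; module
    · rw [Matrix.one_mul]
    · rw [Matrix.mul_one, Matrix.transpose_smul, Matrix.transpose_sub, Matrix.transpose_transpose]
    · module
  · ext1
    · simp only [Matrix.mul_one]; module
    · simp only; module
    · simp only [Matrix.mul_one, Matrix.transpose_add, Matrix.transpose_sub, Matrix.transpose_smul,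
        Matrix.transpose_transpose]; module
    · simp only; module

/-! ### The normalized passivity inequality of a complex model -/

theorem re_lmi_one (N : Model ℂ n m) (z : Fin n → ℂ) (w : Fin m → ℂ) :
    (star (Sum.elim z w) ⬝ᵥ (N.lmi 1 *ᵥ Sum.elim z w)).re =
      2 * ((star w ⬝ᵥ (N.C *ᵥ z + N.D *ᵥ w)).re - (star z ⬝ᵥ (N.A *ᵥ z + N.B *ᵥ w)).re) := by
  have h1 : N.lmi 1 = (Matrix.fromBlocks (-N.A) (-N.B) N.C N.D)ᴴ +
      Matrix.fromBlocks (-N.A) (-N.B) N.C N.D := by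
    rw [Model.lmi, Matrix.fromBlocks_conjTranspose, Matrix.fromBlocks_add]
    simp [sub_eq_add_neg, add_comm]
  have h2 : star (Sum.elim z w) = Sum.elim (star z) (star w) := by
    ext (i | i) <;> rfl
  rw [h1, re_star_dotProduct_conjTranspose, Matrix.fromBlocks_mulVec, h2, sumElim_dotProduct_sumElim]
  simp only [Sum.elim_comp_inl, Sum.elim_comp_inr, Matrix.neg_mulVec, dotProduct_add,
    dotProduct_neg, Complex.add_re, Complex.neg_re]
  ring

/-- Testing on (v, 0) with v an eigenvector gives strict stability, so no imaginary pole needs a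
residue. Testing on (z, x) with z = (iω - A)⁻¹Bx gives positive realness, since the state term
iω‖z‖² has no real part. -/
theorem passive_of_lmi_one_pos {N : Model ℂ n m}
    (h : ∀ x : Fin n ⊕ Fin m → ℂ, x ≠ 0 → 0 < (star x ⬝ᵥ (N.lmi 1 *ᵥ x)).re) : N.Passive := by
  have hA : ∀ μ : ℂ, IsEigenvalue N.A μ → μ.re < 0 := by
    intro μ hμ
    obtain ⟨v, hv0, hv⟩ := isEigenvalue_iff.1 hμ
    have h1 := h (Sum.elim v 0) fun h0 => hv0 (funext fun i => congrFun h0 (Sum.inl i))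
    have h2 := re_star_dotProduct_self_pos hv0
    have h3 : (star v ⬝ᵥ v).im = 0 := by
      simpa using star_dotProduct_im_eq_zero (Matrix.isHermitian_one (n := Fin n) (α := ℂ)) v
    rw [re_lmi_one, hv, Matrix.mulVec_zero, Matrix.mulVec_zero, add_zero, add_zero, star_zero, zero_dotProduct, dotProduct_smul,
      smul_eq_mul, Complex.mul_re, h3, mul_zero, sub_zero, Complex.zero_re, zero_sub] at h1
    nlinarith
  have hnot : ∀ ω : ℝ, ¬ IsEigenvalue N.A (Complex.I * ω) := fun ω he => by
    have := hA _ he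
    simp at this
  refine ⟨fun ω hω => (posDef_popov_of_re_pos N ω fun x hx => ?_).posSemidef,
    fun μ hμ => ⟨(hA μ hμ).le, fun h0 => absurd h0 (hA μ hμ).ne⟩, fun ω he => absurd he (hnot ω)⟩
  set z := ((Complex.I * ω) • (1 : Matrix (Fin n) (Fin n) ℂ) - N.A)⁻¹ *ᵥ (N.B *ᵥ x) with hz
  have hu := (Matrix.isUnit_iff_isUnit_det _).1 (isUnit_resolvent hω)
  have hz' : N.A *ᵥ z + N.B *ᵥ x = (Complex.I * ω) • z := by
    have : ((Complex.I * ω) • (1 : Matrix (Fin n) (Fin n) ℂ) - N.A) *ᵥ z = N.B *ᵥ x := by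
      rw [hz, Matrix.mulVec_mulVec, Matrix.mul_nonsing_inv _ hu, Matrix.one_mulVec]
    rw [← this, Matrix.sub_mulVec, Matrix.smul_mulVec, Matrix.one_mulVec]
    abel
  have h1 := h (Sum.elim z x) fun h0 => hx (funext fun i => congrFun h0 (Sum.inr i))
  have h3 : (star z ⬝ᵥ z).im = 0 := by
    simpa using star_dotProduct_im_eq_zero (Matrix.isHermitian_one (n := Fin n) (α := ℂ)) z
  rw [re_lmi_one, hz', dotProduct_smul, smul_eq_mul, Complex.mul_re, h3] at h1
  rw [transfer_mulVec hω hz']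
  simpa using h1

/-! ### Perturbations -/

theorem lmi_perturb (N Δ : Model ℂ n m) (X : Matrix (Fin n) (Fin n) ℂ) :
    (N.perturb Δ).lmi X = N.lmi X + Δ.lmi X := by
  simp only [Model.lmi, Model.perturb, Matrix.fromBlocks_add, Matrix.conjTranspose_add,
    Matrix.add_mul, Matrix.mul_add]
  congr 1 <;> abel

theorem lmi_toComplex_one (N : Model ℝ n m) : N.toComplex.lmi 1 = cpx (N.lmi 1) := by
  rw [lmi_real]
  simp only [Model.lmi, cpx_fromBlocks, cpx_sub, cpx_add, cpx_neg, cpx_mul, cpx_one,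
    Model.toComplex, cpx_conjTranspose]

theorem re_star_dotProduct_self {ι : Type} [Fintype ι] (x : ι → ℂ) :
    (star x ⬝ᵥ x).re = ‖WithLp.toLp 2 x‖ ^ 2 := by
  rw [EuclideanSpace.norm_sq_eq]
  simp [dotProduct, ← Complex.normSq_eq_norm_sq, Complex.normSq_apply]

theorem neg_specNorm_le_re_lmi_one (Δ : Model ℂ n m) (x : Fin n ⊕ Fin m → ℂ) :
    -(2 * specNorm Δ * ‖WithLp.toLp 2 x‖ ^ 2) ≤ (star x ⬝ᵥ (Δ.lmi 1 *ᵥ x)).re := by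
  obtain ⟨z, w, rfl⟩ : ∃ z w, x = Sum.elim z w :=
    ⟨x ∘ Sum.inl, x ∘ Sum.inr, (Sum.elim_comp_inl_inr x).symm⟩
  set x := Sum.elim z w with hx
  -- Flipping the sign of the state part is an isometry and turns the form of 𝒲(I, Δ) into 2 Re⟨y,
  -- Δx⟩, whence the factor 2.
  set y : Fin n ⊕ Fin m → ℂ := Sum.elim (-z) w with hy
  have hyx : ‖WithLp.toLp 2 y‖ = ‖WithLp.toLp 2 x‖ := by
    rw [EuclideanSpace.norm_eq, EuclideanSpace.norm_eq]
    simp [hx, hy]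
  have h2 : star y = Sum.elim (-star z) (star w) := by
    ext (i | i) <;> simp [hy]
  have h1 : (star x ⬝ᵥ (Δ.lmi 1 *ᵥ x)).re =
      2 * (inner ℂ (WithLp.toLp 2 y)
        (Matrix.toEuclideanCLM (n := Fin n ⊕ Fin m) (𝕜 := ℂ) Δ.blockMatrix (WithLp.toLp 2 x))).re := by
    rw [EuclideanSpace.inner_eq_star_dotProduct, Matrix.toEuclideanCLM_toLp,
      dotProduct_comm _ (star (WithLp.toLp 2 y).ofLp), hx, re_lmi_one, Model.blockMatrix, Matrix.fromBlocks_mulVec, h2, sumElim_dotProduct_sumElim]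
    simp only [Sum.elim_comp_inl, Sum.elim_comp_inr, neg_dotProduct, Complex.add_re, Complex.neg_re]
    ring
  have h3 := (Complex.abs_re_le_norm _).trans (norm_inner_le_norm (𝕜 := ℂ) (WithLp.toLp 2 y)
    (Matrix.toEuclideanCLM (n := Fin n ⊕ Fin m) (𝕜 := ℂ) Δ.blockMatrix (WithLp.toLp 2 x)))
  have h4 := (Matrix.toEuclideanCLM (n := Fin n ⊕ Fin m) (𝕜 := ℂ) Δ.blockMatrix).le_opNorm
    (WithLp.toLp 2 x)
  have h5 := h3.trans (mul_le_mul_of_nonneg_left h4 (norm_nonneg _))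
  rw [hyx] at h5
  rw [h1]
  have h6 := (abs_le.1 h5).1
  rw [specNorm]
  linarith

theorem re_lmi_one_perturb_ge {N : Model ℝ n m} {ξ : ℝ}
    (h : (N.lmi 1 - ξ • (1 : Matrix (Fin n ⊕ Fin m) (Fin n ⊕ Fin m) ℝ)).PosSemidef)
    (Δ : Model ℂ n m) (x : Fin n ⊕ Fin m → ℂ) :
    (ξ - 2 * specNorm Δ) * ‖WithLp.toLp 2 x‖ ^ 2 ≤
      (star x ⬝ᵥ ((N.toComplex.perturb Δ).lmi 1 *ᵥ x)).re := by
  have h1 := re_nonneg_of_posSemidef (posSemidef_cpx h) x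
  rw [cpx_sub, cpx_smul, cpx_one, Matrix.sub_mulVec, dotProduct_sub, Complex.sub_re,
    Matrix.smul_mulVec, Matrix.one_mulVec, dotProduct_smul, smul_eq_mul, Complex.re_ofReal_mul,
    re_star_dotProduct_self] at h1
  have h2 := neg_specNorm_le_re_lmi_one Δ x
  rw [lmi_perturb, lmi_toComplex_one, Matrix.add_mulVec, dotProduct_add, Complex.add_re]
  linarith

theorem specNorm_le_frobNorm (Δ : Model ℂ n m) : specNorm Δ ≤ frobNorm Δ := by
  refine ContinuousLinearMap.opNorm_le_bound _ (Real.sqrt_nonneg _) fun x => ?_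
  rw [frobNorm, EuclideanSpace.norm_eq, EuclideanSpace.norm_eq, ← Real.sqrt_mul (by positivity)]
  refine Real.sqrt_le_sqrt ?_
  rw [Finset.sum_mul]
  refine Finset.sum_le_sum fun i _ => ?_
  rw [Matrix.ofLp_toEuclideanCLM]
  refine le_trans ?_ (Finset.sum_mul_sq_le_sq_mul_sq Finset.univ (fun j => ‖Δ.blockMatrix i j‖)
    fun j => ‖x j‖)
  refine pow_le_pow_left₀ (norm_nonneg _) ?_ 2
  rw [Matrix.mulVec, dotProduct]
  exact (norm_sum_le _ _).trans_eq (by simp only [norm_mul])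

theorem le_passivityRadius {N : Model ℝ n m} {ξ : ℝ}
    (h : (N.lmi 1 - ξ • (1 : Matrix (Fin n ⊕ Fin m) (Fin n ⊕ Fin m) ℝ)).PosSemidef)
    {ν : Model ℂ n m → ℝ} (hν : ∀ Δ, specNorm Δ ≤ ν Δ) :
    ((ξ / 2 : ℝ) : EReal) ≤ N.passivityRadius ν := by
  refine le_iInf₂ fun Δ hΔ => EReal.coe_le_coe_iff.2 ((?_ : ξ / 2 ≤ specNorm Δ).trans (hν Δ))
  by_contra hlt
  refine hΔ (passive_of_lmi_one_pos fun x hx => ?_)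
  refine lt_of_lt_of_le (mul_pos (by linarith) ?_) (re_lmi_one_perturb_ge h Δ x)
  rw [← re_star_dotProduct_self]
  exact re_star_dotProduct_self_pos hx

theorem le_certPassivityRadius {N : Model ℝ n m} {ξ : ℝ}
    (h : (N.lmi 1 - ξ • (1 : Matrix (Fin n ⊕ Fin m) (Fin n ⊕ Fin m) ℝ)).PosSemidef)
    {ν : Model ℂ n m → ℝ} (hν : ∀ Δ, specNorm Δ ≤ ν Δ) :
    ((ξ / 2 : ℝ) : EReal) ≤ N.certPassivityRadius ν 1 := by
  refine le_iInf₂ fun Δ hΔ => EReal.coe_le_coe_iff.2 ((?_ : ξ / 2 ≤ specNorm Δ).trans (hν Δ))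
  by_contra hlt
  have hΔ' : ((N.toComplex.perturb Δ).lmi (cpx 1)).det = 0 := hΔ
  rw [cpx_one] at hΔ'
  obtain ⟨x, hx, h0⟩ := Matrix.exists_mulVec_eq_zero_iff.2 hΔ'
  have h1 := re_lmi_one_perturb_ge h Δ x
  rw [h0, dotProduct_zero, Complex.zero_re, ← re_star_dotProduct_self] at h1
  exact absurd h1 (not_le.2 (mul_pos (by linarith) (re_star_dotProduct_self_pos hx)))

end PassiveLTI

/-! ### Assembly of the claims. -/

theorem mainTheorem1 {n m k : ℕ} (M : Model ℝ n m)
    (hmin : M.Minimal) (hpass : M.toComplex.StrictlyPassive)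
    (ξ : ℝ) (hξ0 : 0 < ξ) (hξ : (ξ : EReal) < M.shiftSup)
    (U V : Matrix (Fin n) (Fin k) ℝ) (W : Matrix (Fin m) (Fin k) ℝ)
    (R : Matrix (Fin k) (Fin k) ℝ)
    (hdefl : (M.shift ξ).IsDeflatingBasis U V W R)
    (hR : ∀ μ : ℂ, IsEigenvalue (cpx R) μ → 0 < μ.re) :
    -- full column rank
    U.rank = k ∧ V.rank = k ∧
    -- `X̂ = -UᵀV` is symmetric positive definite
    (-(Uᵀ * V)).IsSymm ∧ (-(Uᵀ * V)).PosDef ∧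
    -- interpolation at infinity
    Filter.Tendsto M.toComplex.transfer (Bornology.cobounded ℂ) (nhds (cpx M.D)) ∧
    Filter.Tendsto (M.project U V).toComplex.transfer (Bornology.cobounded ℂ)
      (nhds (cpx M.D)) ∧
    -- tangential interpolation for every eigenpair of `R`
    (∀ (σ : ℂ) (r : Fin k → ℂ),
      Module.End.HasEigenvector (Matrix.toLin' (cpx R)) σ r →
      (¬ IsEigenvalue (cpx M.A) (σ - ξ / 2) ∧
        ¬ IsEigenvalue (cpx (M.project U V).A) (σ - ξ / 2) ∧
        M.toComplex.transfer (σ - ξ / 2) *ᵥ (cpx W *ᵥ r) =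
          (M.project U V).toComplex.transfer (σ - ξ / 2) *ᵥ (cpx W *ᵥ r)) ∧
      (¬ IsEigenvalue (cpx M.A) (-σ - ξ / 2) →
        ¬ IsEigenvalue (cpx (M.project U V).A) (-σ - ξ / 2) →
        (cpx W *ᵥ r) ᵥ* M.toComplex.transfer (-σ - ξ / 2) =
          (cpx W *ᵥ r) ᵥ* (M.project U V).toComplex.transfer (-σ - ξ / 2))) ∧
    -- the linear matrix inequality `𝒲(X̂, M̂) ⪰ ξ diag(X̂, I) ≻ 0`
    ((M.project U V).lmi (-(Uᵀ * V)) -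
      ξ • Matrix.fromBlocks (-(Uᵀ * V)) 0 0 (1 : Matrix (Fin m) (Fin m) ℝ)).PosSemidef ∧
    (ξ • Matrix.fromBlocks (-(Uᵀ * V)) 0 0 (1 : Matrix (Fin m) (Fin m) ℝ)).PosDef ∧
    -- the normalized port-Hamiltonian realization and its passivity radius
    (∀ T : Matrix (Fin k) (Fin k) ℝ, -(Uᵀ * V) = Tᵀ * T →
      ((M.project U V).transform T).IsNormalizedPortHamiltonian ∧
      ((ξ / 2 : ℝ) : EReal) ≤ ((M.project U V).transform T).passivityRadius specNorm ∧
      ((ξ / 2 : ℝ) : EReal) ≤ ((M.project U V).transform T).passivityRadius frobNorm ∧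
      ((ξ / 2 : ℝ) : EReal) ≤ ((M.project U V).transform T).certPassivityRadius specNorm 1 ∧
      ((ξ / 2 : ℝ) : EReal) ≤ ((M.project U V).transform T).certPassivityRadius frobNorm 1) := by
  have hP := strictlyPassive_shift_of_lt_shiftSup M hξ
  have hsymm := hdefl.isSymm hR
  have hX := hdefl.posDef hmin.1 hP hR
  have hY := isUnit_det_of_posDef_neg hX
  have hlmi := hdefl.lmi_project_posSemidef hsymm hX hP
  refine ⟨rank_left_of_posDef hX, rank_right_of_posDef hX, ?_, hX, tendsto_transfer _,
    tendsto_transfer (M.project U V).toComplex, ?_, hlmi, ?_, ?_⟩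
  · rw [Matrix.IsSymm, Matrix.transpose_neg, hsymm.eq]
  · intro σ r hr
    have hσ : 0 < σ.re := hR σ (Module.End.hasEigenvalue_of_hasEigenvector hr)
    have hr' : cpx R *ᵥ r = σ • r := by simpa using hr.apply_eq_smul
    have hA : ¬ IsEigenvalue (cpx M.A) (σ - ξ / 2) := fun he =>
      lt_asymm hσ (hP.2 σ ((isEigenvalue_shift M ξ σ).2 he))
    have hA' : ¬ IsEigenvalue (cpx (M.project U V).A) (σ - ξ / 2) := fun he => by
      have := re_eigenvalue_le_of_lmi hX hlmi he
      simp at this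
      linarith
    exact ⟨⟨hA, hA', hdefl.interpolation_right hY hr' hA hA'⟩,
      fun h1 h2 => hdefl.interpolation_left hsymm hY hr' h1 h2⟩
  · exact (posDef_fromBlocks_one hX).smul hξ0
  · intro T hT
    -- TᵀT is positive definite and T is square, so T is invertible.
    have hTdet : IsUnit T.det := by
      have h1 : IsUnit (-(Uᵀ * V)).det := (Matrix.isUnit_iff_isUnit_det _).1 hX.isUnit
      rw [hT, Matrix.det_mul] at h1
      exact isUnit_of_mul_isUnit_right h1
    have h1 : (((M.project U V).transform T).lmi 1 -
        ξ • (1 : Matrix (Fin k ⊕ Fin m) (Fin k ⊕ Fin m) ℝ)).PosSemidef := by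
      rw [lmi_transform _ hTdet, ← hT]
      exact hlmi.conjTranspose_mul_mul_same _
    have h2 : (((M.project U V).transform T).lmi 1).PosSemidef := by
      have := h1.add (Matrix.PosSemidef.one.smul hξ0.le)
      rwa [sub_add_cancel] at this
    exact ⟨isNormalizedPortHamiltonian_of_lmi h2,
      le_passivityRadius h1 fun _ => le_rfl, le_passivityRadius h1 specNorm_le_frobNorm,
      le_certPassivityRadius h1 fun _ => le_rfl, le_certPassivityRadius h1 specNorm_le_frobNorm⟩
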